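/- **Conventions.** Let $\mathbf V$ be a variety of groups (the class of all groups satisfying a given set of laws). A group is *$\mathbf V$-free* on a family $X$ if it lies in $\mathbf V$ and has the universal property of the free object on $X$ with respect to $\mathbf V$; $\mathcal F_{\mathbf V}$ (resp. $\mathcal F^\infty_{\mathbf V}$) is the class of $\mathbf V$-free groups (resp. those of infinite rank), the trivial group (rank $0$) included in $\mathcal F_{\mathbf V}$. $A*C$ denotes the free product (coproduct) in $\mathbf V$. For $A\le B$ in $\mathcal F_{\mathbf V}$, $A\leqslant_*^{\mathrm{ff}}B$ means that $B=A*C$ for some subgroup $C\in\mathcal F_{\mathbf V}$ of $B$. $\mathbf V$ is *torsion-free* if it is nontrivial and every $\mathbf V$-free group is torsion-free. For a structure $M$ and $S\subseteq M$, $\mathrm{dcl}^{\mathrm{qf}}_M(S)$ is the least $T\supseteq S$ that contains every element of $M$ which is the unique solution in $M$ of a quantifier-free formula with parameters in $T$. **RCP.** An *RCP-witness* is a $\mathbf V$-free group $B$ with free basis $\{b_i:i<\omega\}$ and elements $a_i\in B$ $(i<\omega)$ such that, with $A=\langle a_i:i<\omega\rangle$: (a) $A$ is $\mathbf V$-free on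 $\{a_i:i<\omega\}$ and $\langle a_j:j\le i\rangle\leqslant_*^{\mathrm{ff}}B$ for every $i$; (b) $A\not\leqslant_*^{\mathrm{ff}}B*C$ for every $C\in\mathcal F_{\mathbf V}$; (c) $\mathrm{dcl}^{\mathrm{qf}}_B(A\cup\{b_0\})=B$. $\mathbf V$ *satisfies RCP* if an RCP-witness exists. **AEC-coverings.** An abstract elementary class (AEC) $(\mathcal K,\preccurlyeq)$ in the language $L$ of groups is a class of $L$-structures with a partial order $\preccurlyeq$ refining the substructure relation, closed under isomorphism, and satisfying the Tarski–Vaught chain axioms (unions of increasing continuous $\preccurlyeq$-chains, including smoothness), coherence and the Löwenheim–Skolem–Tarski axiom. It is an *AEC-covering of $(\mathcal F_{\mathbf V},\leqslant_*^{\mathrm{ff}})$* if $\mathcal F^\infty_{\mathbf V}\subseteq\mathcal K$; for $G,H\in\mathcal F_{\mathbf V}\cap\mathcal K$, $G\leqslant_*^{\mathrm{ff}}H$ implies $G\preccurlyeq H$; and $(\mathcal K,\preccurlyeq)$ has the amalgamation and joint embedding properties. It is *strong enough with respect to an RCP-witness* $(B,(a_i),(b_i))$, $A=\langle a_i:i<\omega\rangle$,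 if (i) for $X,Y,Z\in\mathcal F^\infty_{\mathbf V}$, $X\preccurlyeq Y$ implies $X*Z\preccurlyeq Y*Z$ (i.e. the canonical map is injective with image $\preccurlyeq Y*Z$); (ii) if $B\preccurlyeq M\in\mathcal K$, then $\mathrm{dcl}^{\mathrm{qf}}_B(A\cup\{b_0\})=\mathrm{dcl}^{\mathrm{qf}}_M(A\cup\{b_0\})$; (iii) for all sufficiently large $\kappa$ and every $(\kappa,\preccurlyeq)$-universal and $(\kappa,\preccurlyeq)$-homogeneous (monster) model $\mathfrak M\in\mathcal K$ with $B\preccurlyeq\mathfrak M$, and every $f\in\mathrm{Aut}(\mathfrak M)$ fixing $A$ pointwise, $\mathrm{dcl}^{\mathrm{qf}}_{\mathfrak M}(A\cup\{b_0\})=\mathrm{dcl}^{\mathrm{qf}}_{\mathfrak M}(A\cup\{f(b_0)\})$. Here $(\kappa,\preccurlyeq)$-universal means that every $N\in\mathcal K$ with $|N|\le\kappa$ embeds strongly into $\mathfrak M$, and $(\kappa,\preccurlyeq)$-homogeneous means that every isomorphism between strong submodels of $\mathfrak M$ of size $<\kappa$ extends to an automorphism of $\mathfrak M$. In (ii) and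 (iii), $B$ may be replaced by any isomorphic copy. $(\mathcal K,\preccurlyeq)$ is *$\lambda$-stable* if there are at most $\lambda$ Galois types (of single elements) over each $M\in\mathcal K$ of size $\lambda$, and *superstable* if there is $\mu$ such that it is $\lambda$-stable for all $\lambda\ge\mu$. **Corollary.** Let $\mathbf V$ be a torsion-free variety of groups such that, whenever $F$ is $\mathbf V$-free on a set $X$, $x\in X$, $y\in F$ and $0<n<\omega$, $x^n=y^n$ implies $x=y$. Then: 1. If $B$ is $\mathbf V$-free on $\{b_i:i<\omega\}$ and $a_i=b_ib_{i+1}^{-2}$, then $(B,(a_i),(b_i))$ is an RCP-witness. In particular, $\mathbf V$ satisfies RCP. 2. If $(\mathcal K,\preccurlyeq)$ is an AEC-covering of $(\mathcal F_{\mathbf V},\leqslant_*^{\mathrm{ff}})$ that is strong enough with respect to some RCP-witness, then $(\mathcal K,\preccurlyeq)$ is not superstable. -/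

import Mathlib

open FirstOrder Cardinal

universe u w

namespace ConstructionPrinciple

/-! ### Abstract elementary classes -/

section AEC

variable {L : FirstOrder.Language.{0, 0}}

/-- An element `x` is quantifier-free definable over a set `T` in `M` if it is the unique solution
in `M` of a quantifier-free formula with parameters from `T`. -/
def IsQFDefinable (L : FirstOrder.Language.{0, 0}) {M : Type w} [L.Structure M] (T : Set M) (x : M) : Prop :=
  ∃ φ : L.Formula (T ⊕ Unit), φ.IsQF ∧
    ∀ y : M, φ.Realize (Sum.elim (fun t : T => (t : M)) (fun _ => y)) ↔ y = x

/-- The quantifier-free definable closure of `S` in `M`: the least set that contains `S` and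
every element quantifier-free definable over it. -/
def dclQF (L : FirstOrder.Language.{0, 0}) {M : Type w} [L.Structure M] (S : Set M) : Set M :=
  ⋂₀ {T : Set M | S ⊆ T ∧ ∀ x, IsQFDefinable L T x → x ∈ T}

/-- An `L`-structure, bundled. -/
abbrev asStr (L : FirstOrder.Language.{0, 0}) (M : Type w) [L.Structure M] :
    CategoryTheory.Bundled.{w} L.Structure :=
  CategoryTheory.Bundled.of M

/-- A class of `L`-structures with a binary relation: `S ∈ K.strong N` means that the substructure
`S` of `N` satisfies `S ≼ N`. -/
structure AbstractClass (L : FirstOrder.Language.{0, 0}) where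
  mod : Set (CategoryTheory.Bundled.{w} L.Structure)
  strong : (N : CategoryTheory.Bundled.{w} L.Structure) → Set (L.Substructure N)

namespace AbstractClass

variable (K : AbstractClass.{w} L)

/-- `S ≼ T`, for substructures `S`, `T` of a common structure `N`. -/
def StrongLE {N : Type w} [L.Structure N] (S T : L.Substructure N) : Prop :=
  S ≤ T ∧ S.comap T.subtype.toHom ∈ K.strong (asStr L T)

/-- Strong embeddings: the image is a strong submodel. -/
def IsStrongEmb {M N : CategoryTheory.Bundled.{w} L.Structure} (f : M ↪[L] N) : Prop :=
  f.toHom.range ∈ K.strong N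

/-- `S` is an increasing continuous `≼`-chain of length `δ`, inside an `L`-structure `N` (which
need not be a member of the class). -/
structure IsChain {N : Type w} [L.Structure N] (δ : Ordinal.{w})
    (S : Ordinal.{w} → L.Substructure N) : Prop where
  mem : ∀ i < δ, asStr L (S i) ∈ K.mod
  mono : ∀ i j, i ≤ j → j < δ → K.StrongLE (S i) (S j)
  cont : ∀ j < δ, Order.IsSuccLimit j → S j = ⨆ i : Set.Iio j, S i

/-- Abstract elementary classes. -/
structure IsAEC : Prop where
  /-- `≼` is a relation on the class. -/
  mem_of_strong : ∀ N, ∀ S ∈ K.strong N, N ∈ K.mod ∧ asStr L S ∈ K.mod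
  mod_iso : ∀ M N : CategoryTheory.Bundled.{w} L.Structure, M ∈ K.mod → (M ≃[L] N) → N ∈ K.mod
  strong_iso : ∀ (M N : CategoryTheory.Bundled.{w} L.Structure) (e : M ≃[L] N),
    ∀ S ∈ K.strong M, S.map e.toHom ∈ K.strong N
  refl : ∀ N ∈ K.mod, ⊤ ∈ K.strong N
  trans : ∀ (N : CategoryTheory.Bundled.{w} L.Structure) (S T : L.Substructure N),
    K.StrongLE S T → T ∈ K.strong N → S ∈ K.strong N
  /-- The union of a chain is in the class, and is a strong extension of its members. -/
  chain_union : ∀ (N : CategoryTheory.Bundled.{w} L.Structure) (δ : Ordinal.{w})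
    (S : Ordinal.{w} → L.Substructure N), Order.IsSuccLimit δ → K.IsChain δ S →
      asStr L ↥(⨆ i : Set.Iio δ, S i) ∈ K.mod ∧
      ∀ j < δ, K.StrongLE (S j) (⨆ i : Set.Iio δ, S i)
  /-- Smoothness. -/
  smooth : ∀ (N : CategoryTheory.Bundled.{w} L.Structure) (δ : Ordinal.{w})
    (S : Ordinal.{w} → L.Substructure N), Order.IsSuccLimit δ → K.IsChain δ S →
      (∀ i < δ, S i ∈ K.strong N) → (⨆ i : Set.Iio δ, S i) ∈ K.strong N
  /-- Coherence. -/
  coherence : ∀ (N : CategoryTheory.Bundled.{w} L.Structure) (S T : L.Substructure N),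
    S ∈ K.strong N → T ∈ K.strong N → S ≤ T → K.StrongLE S T
  /-- The Löwenheim–Skolem–Tarski axiom. -/
  lowenheimSkolem : ∃ μ : Cardinal.{w}, Cardinal.lift.{w} L.card + ℵ₀ ≤ μ ∧
    ∀ N ∈ K.mod, ∀ Y : Set N, ∃ S ∈ K.strong N, Y ⊆ (S : Set N) ∧ #S ≤ #Y + μ

/-- The amalgamation property. -/
def HasAP : Prop :=
  ∀ (M N₁ N₂ : CategoryTheory.Bundled.{w} L.Structure) (f₁ : M ↪[L] N₁) (f₂ : M ↪[L] N₂),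
    M ∈ K.mod → K.IsStrongEmb f₁ → K.IsStrongEmb f₂ →
    ∃ (P : CategoryTheory.Bundled.{w} L.Structure) (g₁ : N₁ ↪[L] P) (g₂ : N₂ ↪[L] P),
      K.IsStrongEmb g₁ ∧ K.IsStrongEmb g₂ ∧ ∀ x : M, g₁ (f₁ x) = g₂ (f₂ x)

/-- The joint embedding property. -/
def HasJEP : Prop :=
  ∀ N₁ N₂ : CategoryTheory.Bundled.{w} L.Structure, N₁ ∈ K.mod → N₂ ∈ K.mod →
    ∃ (P : CategoryTheory.Bundled.{w} L.Structure) (g₁ : N₁ ↪[L] P) (g₂ : N₂ ↪[L] P),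
      K.IsStrongEmb g₁ ∧ K.IsStrongEmb g₂

/-- `M` is a monster model for the cardinal `κ`: it is `(κ, ≼)`-universal and
`(κ, ≼)`-homogeneous. -/
structure IsMonster (κ : Cardinal.{w}) (M : CategoryTheory.Bundled.{w} L.Structure) : Prop where
  mem : M ∈ K.mod
  universal : ∀ N ∈ K.mod, #N ≤ κ → ∃ f : N ↪[L] M, K.IsStrongEmb f
  homogeneous : ∀ S ∈ K.strong M, ∀ T ∈ K.strong M, #S < κ → #T < κ → ∀ e : S ≃[L] T,
    ∃ π : M ≃[L] M, ∀ x : S, π x = e x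

/-- An element of a strong extension of `M`. -/
structure PreType (M : CategoryTheory.Bundled.{w} L.Structure) where
  ext : CategoryTheory.Bundled.{w} L.Structure
  emb : M ↪[L] ext
  isStrong : K.IsStrongEmb emb
  elt : ext

/-- Two elements of strong extensions of `M` are identified by strong embeddings over `M`
into a common extension. -/
def PreType.Rel {K : AbstractClass.{w} L} {M : CategoryTheory.Bundled.{w} L.Structure}
    (p q : K.PreType M) : Prop :=
  ∃ (P : CategoryTheory.Bundled.{w} L.Structure) (g : p.ext ↪[L] P) (h : q.ext ↪[L] P),
    K.IsStrongEmb g ∧ K.IsStrongEmb h ∧ (∀ x : M, g (p.emb x) = h (q.emb x)) ∧ g p.elt = h q.elt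

/-- Galois types (of elements) over `M`: the quotient by the equivalence relation generated by
`PreType.Rel` (which is itself an equivalence relation when amalgamation holds). -/
def GaloisType (M : CategoryTheory.Bundled.{w} L.Structure) : Type (w + 1) :=
  Quot (PreType.Rel (K := K) (M := M))

/-- `λ`-stability: there are at most `λ` Galois types over every model of cardinality `λ`. -/
def IsStableIn (lam : Cardinal.{w}) : Prop :=
  ∀ M ∈ K.mod, #M = lam → #(K.GaloisType M) ≤ Cardinal.lift.{w + 1} lam

/-- Superstability: stability in all cardinals of some tail. -/
def IsSuperstable : Prop :=
  ∃ μ : Cardinal.{w}, ∀ lam : Cardinal.{w}, μ ≤ lam → K.IsStableIn lam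

end AbstractClass

end AEC

/-! ### Groups as first-order structures -/

/-- The function symbols of the language of groups. -/
inductive GroupFunc : ℕ → Type
  | one : GroupFunc 0
  | inv : GroupFunc 1
  | mul : GroupFunc 2

/-- The language of groups. -/
def groupLang : FirstOrder.Language.{0, 0} where
  Functions := GroupFunc
  Relations := fun _ => Empty

/-- Every group is a structure in the language of groups. -/
instance groupStructure (G : Type u) [Group G] : groupLang.Structure G where
  funMap := fun {_} f x =>
    match f, x with
    | GroupFunc.one, _ => 1
    | GroupFunc.inv, x => (x 0)⁻¹
    | GroupFunc.mul, x => x 0 * x 1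
  RelMap := fun {_} r _ => nomatch r

/-- A subgroup as a substructure. -/
def toSub {G : Type u} [Group G] (A : Subgroup G) : groupLang.Substructure G where
  carrier := A
  fun_mem := fun {_} f x hx => by
    match f, x, hx with
    | GroupFunc.one, _, _ => exact A.one_mem
    | GroupFunc.inv, x, hx => exact A.inv_mem (hx 0)
    | GroupFunc.mul, x, hx => exact A.mul_mem (hx 0) (hx 1)

/-! ### Varieties of groups and their free objects

A variety is given by a set `W` of laws, words in countably many letters. -/

section Variety

variable (W : Set (FreeGroup ℕ))

/-- The group `G` belongs to the variety defined by the laws in `W`. -/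
def InVariety (G : Type u) [Group G] : Prop :=
  ∀ r ∈ W, ∀ v : ℕ → G, FreeGroup.lift v r = 1

/-- `G` belongs to the variety and is freely generated in it by the family `b`. -/
def IsFreeBasis {ι : Type w} {G : Type u} [Group G] (b : ι → G) : Prop :=
  InVariety W G ∧ ∀ (H : Type u) [Group H], InVariety W H → ∀ f : ι → H,
    ∃! φ : G →* H, ∀ i, φ (b i) = f i

/-- `G` is a free object of the variety. -/
def IsFree (G : Type u) [Group G] : Prop :=
  ∃ X : Set G, IsFreeBasis W (fun x : X => (x : G))

/-- `G` is a free object of infinite rank of the variety. -/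
def IsFreeInf (G : Type u) [Group G] : Prop :=
  ∃ X : Set G, X.Infinite ∧ IsFreeBasis W (fun x : X => (x : G))

/-- `D`, with the homomorphisms `β` and `γ`, is the free product `B * C` in the variety. -/
def IsFreeProduct {B C D : Type u} [Group B] [Group C] [Group D] (β : B →* D) (γ : C →* D) :
    Prop :=
  InVariety W D ∧ ∀ (H : Type u) [Group H], InVariety W H → ∀ (f : B →* H) (g : C →* H),
    ∃! φ : D →* H, φ.comp β = f ∧ φ.comp γ = g

/-- `A` is a free factor, with free complement, of the free object `G`; here `A` is free too. -/
def IsFreeFactor {G : Type u} [Group G] (A : Subgroup G) : Prop :=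
  IsFree W G ∧ IsFree W A ∧ ∃ C : Subgroup G, IsFree W C ∧ IsFreeProduct W A.subtype C.subtype

/-- The variety is nontrivial and its free objects are torsion-free. -/
def IsTorsionFreeVariety : Prop :=
  (∃ (G : Type u) (_ : Group G), InVariety W G ∧ Nontrivial G) ∧
  ∀ (G : Type u) [Group G], IsFree W G → ∀ (x : G) (n : ℕ), 0 < n → x ^ n = 1 → x = 1

/-- The group `B`, its free basis `b` and the subgroup `A` generated by the family `a` are a
witness of the Reinforced Construction Principle. -/
structure IsRCPWitness (B : Type u) [Group B] (a b : ℕ → B) : Prop where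
  free_b : IsFreeBasis W b
  free_a : IsFreeBasis W
    (fun i => (⟨a i, Subgroup.subset_closure ⟨i, rfl⟩⟩ : Subgroup.closure (Set.range a)))
  initial_factor : ∀ i : ℕ, IsFreeFactor W (Subgroup.closure (a '' {j | j ≤ i}))
  not_factor : ∀ (C D : Type u) [Group C] [Group D] (β : B →* D) (γ : C →* D),
    IsFree W C → IsFreeProduct W β γ → ¬ IsFreeFactor W ((Subgroup.closure (Set.range a)).map β)
  dcl_eq : dclQF groupLang ((Subgroup.closure (Set.range a) : Set B) ∪ {b 0}) = Set.univ

/-- The Reinforced Construction Principle. -/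
def RCP : Prop :=
  ∃ (B : Type u) (_ : Group B) (a b : ℕ → B), IsRCPWitness W B a b

/-- `K` is an AEC-covering of the class of free objects with the relation of being a free factor
with free complement. -/
structure IsAECCovering (K : AbstractClass.{u} groupLang) : Prop where
  free_mem : ∀ (G : Type u) [Group G], IsFreeInf W G → asStr groupLang G ∈ K.mod
  isAEC : K.IsAEC
  strong_of_factor : ∀ (G : Type u) [Group G] (A : Subgroup G), asStr groupLang G ∈ K.mod →
    asStr groupLang A ∈ K.mod → IsFreeFactor W A → toSub A ∈ K.strong (asStr groupLang G)
  ap : K.HasAP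
  jep : K.HasJEP

/-- `K` is strong enough, with respect to the pair of the group `B`, with free basis `b`, and its
subgroup `A` generated by the family `a`. -/
structure IsStrongEnough (K : AbstractClass.{u} groupLang) (B : Type u) [Group B]
    (a b : ℕ → B) : Prop where
  /-- If `X ≼ Y` then the canonical homomorphism `θ : X * Z → Y * Z` is a strong embedding. -/
  free_product : ∀ (Y Z P Q : Type u) [Group Y] [Group Z] [Group P] [Group Q] (X : Subgroup Y)
    (ξ : X →* P) (ζ : Z →* P) (η : Y →* Q) (ζ' : Z →* Q) (θ : P →* Q),
    IsFreeInf W X → IsFreeInf W Y → IsFreeInf W Z → toSub X ∈ K.strong (asStr groupLang Y) →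
    IsFreeProduct W ξ ζ → IsFreeProduct W η ζ' →
    θ.comp ξ = η.comp X.subtype → θ.comp ζ = ζ' →
    Function.Injective θ ∧ toSub θ.range ∈ K.strong (asStr groupLang Q)
  /-- If `B ≼ M`, then `A ∪ {b 0}` has the same quantifier-free definable closure in `B`
  and in `M`. -/
  dcl_eq : ∀ (M : CategoryTheory.Bundled.{u} groupLang.Structure)
    (j : asStr groupLang B ↪[groupLang] M), K.IsStrongEmb j →
    j '' dclQF groupLang ((Subgroup.closure (Set.range a) : Set B) ∪ {b 0}) =
      dclQF groupLang (j '' ((Subgroup.closure (Set.range a) : Set B) ∪ {b 0}))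
  /-- If `B ≼ M` for a sufficiently large monster model `M`, and `f` is an automorphism of `M`
  fixing `A` pointwise, then `A ∪ {b 0}` and `A ∪ {f (b 0)}` have the same quantifier-free
  definable closure in `M`. -/
  dcl_aut : ∃ κ₀ : Cardinal.{u}, ∀ κ, κ₀ ≤ κ →
    ∀ M : CategoryTheory.Bundled.{u} groupLang.Structure, K.IsMonster κ M →
    ∀ j : asStr groupLang B ↪[groupLang] M, K.IsStrongEmb j →
    ∀ f : M ≃[groupLang] M, (∀ x ∈ Subgroup.closure (Set.range a), f (j x) = j x) →
    dclQF groupLang (j '' (Subgroup.closure (Set.range a) : Set B) ∪ {j (b 0)}) =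
      dclQF groupLang (j '' (Subgroup.closure (Set.range a) : Set B) ∪ {f (j (b 0))})

end Variety

end ConstructionPrinciple

open ConstructionPrinciple

/-! Part 1. Replacing the first `n` basis elements `b i` by `a i = b i * b (i + 1) ^ (-2)` is an
invertible triangular substitution (`IsFreeBasis.twist`), so initial segments of `a` are parts of
bases; `A` itself is free on `a` because a relation involves only finitely many letters. Modulo `A`,
each `b i` becomes the square of `b (i + 1)`. If `A` were a free factor of `B * C`, this would
produce successive square roots in its free complement. A torsion-free variety contains all abelian
groups, so a free object has a free abelian abelianization, and `b 0` would die in every abelian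
quotient that kills `A`. Yet `b i ↦ 2⁻ⁱ ∈ ℚ` kills `A` and not `b 0`. Finally, `b (i + 1)` is the
only square root of `(a i)⁻¹ * b i`, so `A` and `b 0` define all of `B`.

Part 2. Choose arbitrarily large `λ` with `λ < λ ^ ℵ₀`, and let `M` be free on the tree of finite
sequences from `λ`. For a branch `ν`, identify its nodes with the `a i` and extend their span as `A`
is extended by `B`. The resulting extension of `M` is strong: it is `A * Y → B * Y`, and `A * Y` is
the union of a chain of free factors of `B * Y`, so smoothness applies (`strong_of_witness`). Let
`x_ν` be the new copy of `b 0`.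

Distinct branches give distinct Galois types of `x_ν` over `M` (`galoisType_ne`). Two branches that
part after level `k` are amalgamated freely over `a 0, …, a k`, and there `x_ν` is outside the copy
of `B` belonging to the other branch `η`, because `b 0 ∉ A` (`b_zero_notMem`). If the types were
equal, an automorphism of a monster model over `M` would send `x_η` to `x_ν`. The two conditions on
definable closure would then put `x_ν` into that copy of `B`. So there are `λ ^ ℵ₀ > λ` types over a
model of size `λ`.

The argument needs actual monster models. They are built from amalgamation and joint embedding as
limits of regular length of back-and-forth extensions (`exists_isMonster`). -/

namespace ConstructionPrinciple

/-! ### Strong embeddings and unions of chains in an AEC. -/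

namespace AbstractClass

open FirstOrder.Language CategoryTheory

variable {L : FirstOrder.Language.{0, 0}} {K : AbstractClass.{w} L}

variable (K) in
/-- Membership in the class, for unbundled structures. -/
def Mem (M : Type w) [L.Structure M] : Prop := asStr L M ∈ K.mod

/-- Strong embeddings of unbundled structures. -/
def Strong (K : AbstractClass.{w} L) {M N : Type w} [L.Structure M] [L.Structure N]
    (f : M ↪[L] N) : Prop :=
  f.toHom.range ∈ K.strong (asStr L N)

variable {M N P : Type w} [L.Structure M] [L.Structure N] [L.Structure P]

theorem strong_congr {f g : M ↪[L] N} (h : ∀ x, f x = g x) (hf : K.Strong f) : K.Strong g := by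
  have : f = g := by ext x; exact h x
  rwa [← this]

theorem strong_subtype {S : L.Substructure N} :
    K.Strong S.subtype ↔ S ∈ K.strong (asStr L N) := by
  unfold Strong
  rw [Substructure.range_subtype]

theorem strongLE_iff_inclusion {S T : L.Substructure N} :
    K.StrongLE S T ↔ ∃ h : S ≤ T, K.Strong (Substructure.inclusion h) := by
  have key : ∀ h : S ≤ T, S.comap T.subtype.toHom = (Substructure.inclusion h).toHom.range := by
    intro h
    ext x
    rw [Substructure.mem_comap, Hom.mem_range]
    constructor
    · intro hx
      exact ⟨⟨x, hx⟩, rfl⟩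
    · rintro ⟨y, rfl⟩
      exact y.2
  constructor
  · rintro ⟨h, hs⟩
    refine ⟨h, ?_⟩
    rw [key h] at hs
    exact hs
  · rintro ⟨h, hs⟩
    refine ⟨h, ?_⟩
    rw [key h]
    exact hs

namespace IsAEC

variable (hK : K.IsAEC)
include hK

theorem mem_equiv (e : M ≃[L] N) (hM : K.Mem M) : K.Mem N :=
  hK.mod_iso (asStr L M) (asStr L N) hM e

theorem cod_mem {f : M ↪[L] N} (hf : K.Strong f) : K.Mem N :=
  (hK.mem_of_strong (asStr L N) _ hf).1

theorem dom_mem {f : M ↪[L] N} (hf : K.Strong f) : K.Mem M :=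
  hK.mem_equiv f.equivRange.symm (hK.mem_of_strong (asStr L N) _ hf).2

theorem strong_equiv (e : M ≃[L] N) (hM : K.Mem M) : K.Strong e.toEmbedding := by
  have h := hK.refl (asStr L N) (hK.mem_equiv e hM)
  have : e.toEmbedding.toHom.range = ⊤ := e.toHom_range
  unfold Strong
  rw [this]
  exact h

theorem strong_refl (hM : K.Mem M) : K.Strong (Embedding.refl L M) :=
  hK.strong_equiv (Language.Equiv.refl L M) hM

/-- Closure under isomorphism carries the image of `f` into the image of `g`; transitivity of `≼`
then applies inside `P`. -/
theorem comp {f : M ↪[L] N} {g : N ↪[L] P} (hf : K.Strong f) (hg : K.Strong g) :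
    K.Strong (g.comp f) := by
  refine hK.trans (asStr L P) (g.comp f).toHom.range g.toHom.range ⟨?_, ?_⟩ hg
  · rintro _ ⟨x, rfl⟩
    exact ⟨f x, rfl⟩
  · have h := hK.strong_iso (asStr L N) (asStr L g.toHom.range) g.equivRange f.toHom.range hf
    have e : (g.comp f).toHom.range.comap g.toHom.range.subtype.toHom =
        f.toHom.range.map g.equivRange.toHom := by
      ext x
      rw [Substructure.mem_comap, Hom.mem_range, Substructure.mem_map]
      constructor
      · rintro ⟨y, hy⟩
        exact ⟨f y, ⟨y, rfl⟩, Subtype.ext hy⟩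
      · rintro ⟨_, ⟨y, rfl⟩, rfl⟩
        exact ⟨y, rfl⟩
    have h' : f.toHom.range.map g.equivRange.toHom ∈ K.strong (asStr L g.toHom.range) := h
    rw [← e] at h'
    exact h'

/-- This is coherence in `P`, pulled back along the isomorphism of `N` with its image. -/
theorem of_comp {f : M ↪[L] N} {g : N ↪[L] P} (hgf : K.Strong (g.comp f)) (hg : K.Strong g) :
    K.Strong f := by
  have h := (hK.coherence (asStr L P) (g.comp f).toHom.range g.toHom.range hgf hg
    (by rintro _ ⟨x, rfl⟩; exact ⟨f x, rfl⟩)).2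
  have h' := hK.strong_iso (asStr L g.toHom.range) (asStr L N) g.equivRange.symm _ h
  have e : ((g.comp f).toHom.range.comap g.toHom.range.subtype.toHom).map
      g.equivRange.symm.toHom = f.toHom.range := by
    ext x
    rw [Hom.mem_range, Substructure.mem_map]
    constructor
    · rintro ⟨z, ⟨y, hy⟩, rfl⟩
      refine ⟨y, ?_⟩
      have : z = g.equivRange (f y) := Subtype.ext hy.symm
      rw [this]
      exact (g.equivRange.symm_apply_apply _).symm
    · rintro ⟨y, rfl⟩
      exact ⟨g.equivRange (f y), ⟨y, rfl⟩, g.equivRange.symm_apply_apply _⟩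
  have h'' : ((g.comp f).toHom.range.comap g.toHom.range.subtype.toHom).map
      g.equivRange.symm.toHom ∈ K.strong (asStr L N) := h'
  rw [e] at h''
  exact h''

theorem strongLE_top {S : L.Substructure N} :
    K.StrongLE S ⊤ ↔ S ∈ K.strong (asStr L N) := by
  rw [strongLE_iff_inclusion, ← strong_subtype]
  constructor
  · rintro ⟨h, hs⟩
    exact strong_congr (fun x => rfl)
      (hK.comp hs (hK.strong_equiv Substructure.topEquiv (hK.cod_mem hs)))
  · intro hs
    refine ⟨le_top, ?_⟩
    refine hK.of_comp (g := (Substructure.topEquiv (L := L) (M := N)).toEmbedding)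
      (strong_congr (fun x => rfl) hs) ?_
    exact hK.strong_equiv _ (hK.mem_equiv Substructure.topEquiv.symm (hK.cod_mem hs))

/-- The relation `≼` is transported by embeddings. -/
theorem strongLE_map (f : M ↪[L] N) {S T : L.Substructure M} :
    K.StrongLE (S.map f.toHom) (T.map f.toHom) ↔ K.StrongLE S T := by
  let eS := f.substructureEquivMap S
  let eT := f.substructureEquivMap T
  rw [strongLE_iff_inclusion, strongLE_iff_inclusion]
  constructor
  · rintro ⟨h, hs⟩
    refine ⟨(Substructure.map_le_map_iff_of_injective f.injective).1 h, ?_⟩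
    have hc := hK.comp (f := eS.toEmbedding) (g := Substructure.inclusion h)
      (hK.strong_equiv eS (hK.mem_equiv eS.symm (hK.dom_mem hs))) hs
    refine hK.of_comp (g := eT.toEmbedding) (strong_congr (fun x => rfl) hc) ?_
    exact hK.strong_equiv eT (hK.mem_equiv eT.symm (hK.cod_mem hs))
  · rintro ⟨h, hs⟩
    refine ⟨(Substructure.map_le_map_iff_of_injective f.injective).2 h, ?_⟩
    refine strong_congr ?_ (hK.comp (hK.comp (hK.strong_equiv eS.symm
      (hK.mem_equiv eS (hK.dom_mem hs))) hs) (hK.strong_equiv eT (hK.cod_mem hs)))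
    intro x
    obtain ⟨y, rfl⟩ := eS.surjective x
    have : eS.symm.toEmbedding (eS y) = y := eS.symm_apply_apply y
    rw [Embedding.comp_apply, Embedding.comp_apply, this]
    rfl

theorem strongLE_trans {S T R : L.Substructure N}
    (h₁ : K.StrongLE S T) (h₂ : K.StrongLE T R) : K.StrongLE S R := by
  rw [strongLE_iff_inclusion] at *
  obtain ⟨h₁, hs₁⟩ := h₁
  obtain ⟨h₂, hs₂⟩ := h₂
  exact ⟨h₁.trans h₂, hK.comp hs₁ hs₂⟩

theorem strongLE_refl {S : L.Substructure N} (h : K.Mem S) : K.StrongLE S S := by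
  rw [strongLE_iff_inclusion]
  exact ⟨le_rfl, hK.strong_refl h⟩

theorem left_mem {S T : L.Substructure N} (h : K.StrongLE S T) : K.Mem S := by
  rw [strongLE_iff_inclusion] at h
  obtain ⟨_, h⟩ := h
  exact hK.dom_mem h

/-- A form of smoothness in which the ambient structure need not belong to the class. -/
theorem smooth_strongLE {δ : Ordinal.{w}}
    {S : Ordinal.{w} → L.Substructure N} (hδ : Order.IsSuccLimit δ) (hS : K.IsChain δ S)
    {T : L.Substructure N} (hT : ∀ i < δ, K.StrongLE (S i) T) :
    K.StrongLE (⨆ i : Set.Iio δ, S i) T := by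
  -- The chain is pulled back into `T`, where all its members are strong and the smoothness axiom
  -- can be used.
  set S' : Ordinal.{w} → L.Substructure T := fun i => (S i).comap T.subtype.toHom with hS'
  have hmap : ∀ i < δ, (S' i).map T.subtype.toHom = S i := by
    intro i hi
    ext x
    rw [Substructure.mem_map]
    constructor
    · rintro ⟨y, hy, rfl⟩
      exact hy
    · intro hx
      exact ⟨⟨x, (hT i hi).1 hx⟩, hx, rfl⟩
  have hsup : ∀ j ≤ δ, (⨆ i : Set.Iio j, S' i).map T.subtype.toHom = ⨆ i : Set.Iio j, S i := by
    intro j hj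
    rw [Substructure.map_iSup]
    exact iSup_congr fun i => hmap i (lt_of_lt_of_le i.2 hj)
  have hinj := Substructure.map_injective_of_injective (L := L) (f := T.subtype.toHom)
    T.subtype.injective
  have hTtop : (⊤ : L.Substructure T).map T.subtype.toHom = T := by
    rw [← Hom.range_eq_map, Substructure.range_subtype]
  have hstr : ∀ i < δ, S' i ∈ K.strong (asStr L T) := fun i hi => (hT i hi).2
  have hchain : K.IsChain δ S' := by
    refine ⟨fun i hi => (hK.mem_of_strong _ _ (hstr i hi)).2, ?_, ?_⟩
    · intro i j hij hj
      rw [← hK.strongLE_map T.subtype, hmap i (hij.trans_lt hj), hmap j hj]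
      exact hS.mono i j hij hj
    · intro j hj hlim
      apply hinj
      rw [hmap j hj, hsup j hj.le]
      exact hS.cont j hj hlim
  have : (⨆ i : Set.Iio δ, S' i) ∈ K.strong (asStr L T) :=
    hK.smooth (asStr L T) δ S' hδ hchain hstr
  rw [← hK.strongLE_top, ← hK.strongLE_map T.subtype, hsup δ le_rfl, hTtop] at this
  exact this

/-- Unions of `≼`-increasing, not necessarily continuous, chains. -/
theorem iSup_chain_ordinal (δ : Ordinal.{w}) (hδ : 0 < δ)
    (S : Ordinal.{w} → L.Substructure N)
    (hS : ∀ i j, i ≤ j → j < δ → K.StrongLE (S i) (S j)) :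
    (∀ j < δ, K.StrongLE (S j) (⨆ i : Set.Iio δ, S i)) ∧
    ∀ T : L.Substructure N, (∀ i < δ, K.StrongLE (S i) T) →
      K.StrongLE (⨆ i : Set.Iio δ, S i) T := by
  induction δ using WellFoundedLT.induction with
  | ind δ IH =>
  rcases Ordinal.zero_or_succ_or_isSuccLimit δ with h0 | ⟨γ, hγ⟩ | hlim
  · exact absurd h0 hδ.ne'
  · have hγδ : γ < δ := by rw [← hγ]; exact Order.lt_succ γ
    have hle : ∀ i < δ, i ≤ γ := fun i hi => by
      rw [← hγ] at hi; exact Order.lt_succ_iff.1 hi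
    have : (⨆ i : Set.Iio δ, S i) = S γ := by
      apply le_antisymm
      · exact iSup_le fun i => (hS i γ (hle i i.2) hγδ).1
      · exact le_iSup (fun i : Set.Iio δ => S i) ⟨γ, hγδ⟩
    rw [this]
    exact ⟨fun j hj => hS j γ (hle j hj) hγδ, fun T hT => hT γ hγδ⟩
  -- `U` is a continuous chain interleaved with `S`: by induction `S i ≼ U j ≼ S j` for `i < j`, so
  -- both have the same unions at limits. The value at `0` is set separately, since the empty union
  -- need not be a model.
  · set U : Ordinal.{w} → L.Substructure N := fun j => if j = 0 then S 0 else ⨆ i : Set.Iio j, S i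
      with hU
    have hU0 : U 0 = S 0 := by simp [hU]
    have hUpos : ∀ j, 0 < j → U j = ⨆ i : Set.Iio j, S i := fun j hj => by simp [hU, hj.ne']
    have IH1 : ∀ i j, i < j → j < δ → K.StrongLE (S i) (U j) := by
      intro i j hij hj
      have hj0 := (bot_le (a := i)).trans_lt hij
      rw [hUpos j hj0]
      exact (IH j hj hj0 fun i k hik hk => hS i k hik (hk.trans hj)).1 i hij
    have IH2 : ∀ j < δ, ∀ T, 0 < j → (∀ i < j, K.StrongLE (S i) T) → K.StrongLE (U j) T := by
      intro j hj T hj0 hT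
      rw [hUpos j hj0]
      exact (IH j hj hj0 fun i k hik hk => hS i k hik (hk.trans hj)).2 T hT
    have hUS : ∀ j < δ, K.StrongLE (U j) (S j) := by
      intro j hj
      rcases eq_zero_or_pos j with rfl | h
      · rw [hU0]
        exact hS 0 0 le_rfl hj
      · exact IH2 j hj _ h fun i hi => hS i j hi.le hj
    have hsup : ∀ j, Order.IsSuccLimit j → j ≤ δ →
        (⨆ i : Set.Iio j, S i) = ⨆ i : Set.Iio j, U i := by
      intro j hj hjδ
      apply le_antisymm
      · refine iSup_le fun i => ?_
        have hi : Order.succ i.1 < j := hj.succ_lt i.2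
        exact (IH1 i _ (Order.lt_succ i.1) (hi.trans_le hjδ)).1.trans
          (le_iSup (fun i : Set.Iio j => U i) ⟨_, hi⟩)
      · refine iSup_le fun i => ?_
        exact (hUS i (lt_of_lt_of_le i.2 hjδ)).1.trans (le_iSup (fun i : Set.Iio j => S i) i)
    have hchain : K.IsChain δ U := by
      refine ⟨fun i hi => hK.left_mem (hUS i hi), ?_, ?_⟩
      · intro i j hij hj
        rcases hij.eq_or_lt with rfl | hij'
        · exact hK.strongLE_refl (hK.left_mem (hUS i hj))
        · exact hK.strongLE_trans (hUS i (hij'.trans hj)) (IH1 i j hij' hj)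
      · intro j hj hjlim
        rw [← hsup j hjlim hj.le, hUpos j hjlim.bot_lt]
    rw [hsup δ hlim le_rfl]
    constructor
    · intro j hj
      have hj' := hlim.succ_lt hj
      exact hK.strongLE_trans (IH1 j _ (Order.lt_succ j) hj')
        ((hK.chain_union (asStr L N) δ U hlim hchain).2 _ hj')
    · intro T hT
      exact hK.smooth_strongLE hlim hchain fun i hi =>
        hK.strongLE_trans (hUS i hi) (hT i hi)

/-- Unions of `≼`-increasing chains indexed by a well-ordered type. -/
theorem iSup_chain {J : Type w} [LinearOrder J] [WellFoundedLT J] [Nonempty J]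
    (S : J → L.Substructure N)
    (hS : ∀ i j, i ≤ j → K.StrongLE (S i) (S j)) :
    (∀ j, K.StrongLE (S j) (⨆ i, S i)) ∧
    ∀ T : L.Substructure N, (∀ i, K.StrongLE (S i) T) → K.StrongLE (⨆ i, S i) T := by
  let δ : Ordinal.{w} := Ordinal.type (α := J) (· < ·)
  let t : J → Ordinal.{w} := fun j => Ordinal.typein (α := J) (· < ·) j
  have ht : ∀ i j, t i ≤ t j ↔ i ≤ j := fun i j => by
    rw [← not_lt, ← not_lt, Ordinal.typein_lt_typein]
  have htδ : ∀ j, t j < δ := fun j => Ordinal.typein_lt_type _ j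
  have hsurj : ∀ o < δ, ∃ j, t j = o := fun o ho => Ordinal.typein_surj _ ho
  let U : Ordinal.{w} → L.Substructure N := fun o => ⨆ (j) (_ : t j ≤ o), S j
  have hU : ∀ j, U (t j) = S j := by
    intro j
    apply le_antisymm
    · exact iSup₂_le fun i hi => (hS i j ((ht i j).1 hi)).1
    · exact le_iSup₂ (f := fun i (_ : t i ≤ t j) => S i) j le_rfl
  have hsup : (⨆ i : Set.Iio δ, U i) = ⨆ j, S j := by
    apply le_antisymm
    · refine iSup_le fun i => ?_
      obtain ⟨j, hj⟩ := hsurj i i.2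
      rw [← hj, hU]
      exact le_iSup S j
    · refine iSup_le fun j => ?_
      rw [← hU]
      exact le_iSup (fun i : Set.Iio δ => U i) ⟨t j, htδ j⟩
  have hmono : ∀ i j, i ≤ j → j < δ → K.StrongLE (U i) (U j) := by
    intro i j hij hj
    obtain ⟨i', rfl⟩ := hsurj i (hij.trans_lt hj)
    obtain ⟨j', rfl⟩ := hsurj j hj
    rw [hU, hU]
    exact hS _ _ ((ht _ _).1 hij)
  obtain ⟨j₀⟩ := ‹Nonempty J›
  have := hK.iSup_chain_ordinal δ (bot_le.trans_lt (htδ j₀)) U hmono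
  rw [hsup] at this
  refine ⟨fun j => ?_, fun T hT => this.2 T fun i hi => ?_⟩
  · rw [← hU j]
    exact this.1 _ (htδ j)
  · obtain ⟨i', rfl⟩ := hsurj i hi
    rw [hU]
    exact hT i'

end IsAEC

end AbstractClass

/-- Construction of monotone families by well-founded recursion, where each term is an upper bound
of the previous ones and satisfies a prescribed condition. -/
theorem exists_monotone_of_step {P : Type*} [Preorder P] [Nonempty P] {J : Type*} [LinearOrder J]
    [WellFoundedLT J] (Q : (j : J) → (Set.Iio j → P) → P → Prop)
    (h : ∀ (j : J) (m : Set.Iio j → P), Monotone m →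
      (∀ i : Set.Iio j, Q i (fun k => m ⟨k, lt_trans k.2 i.2⟩) (m i)) →
      ∃ q, (∀ i, m i ≤ q) ∧ Q j m q) :
    ∃ m : J → P, Monotone m ∧ ∀ j, Q j (fun i => m i) (m j) := by
  classical
  -- The arbitrary default value is never taken: `key` shows by induction that a suitable `q` exists
  -- at every stage.
  let step : (j : J) → ((i : J) → i < j → P) → P := fun j m =>
    if hq : ∃ q, (∀ i : Set.Iio j, m i i.2 ≤ q) ∧ Q j (fun i => m i i.2) q then hq.choose
    else Classical.arbitrary P
  let m : J → P := (wellFounded_lt (α := J)).fix step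
  have hm : ∀ j, m j = step j (fun i _ => m i) := fun j => WellFounded.fix_eq _ _ _
  have key : ∀ j, (∀ i < j, m i ≤ m j) ∧ Q j (fun i => m i) (m j) := by
    intro j
    induction j using WellFoundedLT.induction with
    | ind j IH =>
    have hq : ∃ q, (∀ i : Set.Iio j, m i ≤ q) ∧ Q j (fun i => m i) q := by
      apply h j (fun i => m i)
      · intro i k hik
        rcases (show i.1 ≤ k.1 from hik).eq_or_lt with h | h
        · simp only [h]; exact le_rfl
        · exact (IH k k.2).1 i h
      · exact fun i => (IH i i.2).2
    have : m j = hq.choose := by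
      rw [hm]
      exact dif_pos hq
    rw [this]
    exact ⟨fun i hi => hq.choose_spec.1 ⟨i, hi⟩, hq.choose_spec.2⟩
  refine ⟨m, fun i j hij => ?_, fun j => (key j).2⟩
  rcases hij.eq_or_lt with rfl | h
  · exact le_rfl
  · exact (key j).1 i h

/-! ### Labelled models and their directed limits. -/

namespace AbstractClass

open FirstOrder.Language CategoryTheory

variable {L : FirstOrder.Language.{0, 0}} {K : AbstractClass.{w} L}

/-- A member of the class whose elements are labelled by ordinals. -/
structure LabelledModel (hK : K.IsAEC) where
  carrier : Type w
  [str : L.Structure carrier]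
  mem : K.Mem carrier
  label : carrier → Ordinal.{w}
  label_injective : Function.Injective label

namespace LabelledModel

variable {hK : K.IsAEC}

attribute [instance] LabelledModel.str

/-- Strong embeddings that preserve the labels. -/
def IsLabelEmb (p q : LabelledModel hK) (f : p.carrier ↪[L] q.carrier) : Prop :=
  K.Strong f ∧ ∀ x, q.label (f x) = p.label x

/-- Labels are injective, so a label-preserving embedding is determined by its source and target.
Chains for this preorder are therefore commuting systems automatically, and recursions need not
carry embeddings along. -/
instance : Preorder (LabelledModel hK) where
  le p q := ∃ f : p.carrier ↪[L] q.carrier, IsLabelEmb p q f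
  le_refl p := ⟨Embedding.refl L _, hK.strong_refl p.mem, fun _ => rfl⟩
  le_trans p q r := by
    rintro ⟨f, hf, hf'⟩ ⟨g, hg, hg'⟩
    exact ⟨g.comp f, hK.comp hf hg, fun x => by rw [Embedding.comp_apply, hg', hf']⟩

theorem le_iff {p q : LabelledModel hK} :
    p ≤ q ↔ ∃ f : p.carrier ↪[L] q.carrier, IsLabelEmb p q f := Iff.rfl

/-- New elements receive labels from `s` upwards, where `s` is beyond all labels in use. -/
theorem exists_label_extension {A B : Type w} (f : A → B) (hf : Function.Injective f)
    (l : A → Ordinal.{w}) (hl : Function.Injective l) :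
    ∃ l' : B → Ordinal.{w}, Function.Injective l' ∧ ∀ x, l' (f x) = l x := by
  classical
  let s : Ordinal.{w} := Order.succ (⨆ x, l x)
  let e : B → Ordinal.{w} := fun y => Ordinal.typein (α := B) WellOrderingRel y
  have he : Function.Injective e := Ordinal.typein_injective _
  have hs : ∀ x, l x < s := fun x => Order.lt_succ_of_le (Ordinal.le_iSup l x)
  let l' : B → Ordinal.{w} := fun y => if h : ∃ x, f x = y then l h.choose else s + e y
  have h1 : ∀ x, l' (f x) = l x := by
    intro x
    have h : ∃ x', f x' = f x := ⟨x, rfl⟩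
    have : l' (f x) = l h.choose := dif_pos h
    rw [this, hf h.choose_spec]
  have h2 : ∀ y, (¬ ∃ x, f x = y) → l' y = s + e y := fun y hy => dif_neg hy
  refine ⟨l', ?_, h1⟩
  intro y z hyz
  by_cases hy : ∃ x, f x = y <;> by_cases hz : ∃ x, f x = z
  · obtain ⟨y, rfl⟩ := hy
    obtain ⟨z, rfl⟩ := hz
    rw [h1, h1] at hyz
    rw [hl hyz]
  · obtain ⟨y, rfl⟩ := hy
    rw [h1, h2 _ hz] at hyz
    exact absurd (hs y) (not_lt.2 (hyz ▸ le_self_add))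
  · obtain ⟨z, rfl⟩ := hz
    rw [h1, h2 _ hy] at hyz
    exact absurd (hs z) (not_lt.2 (hyz ▸ le_self_add))
  · rw [h2 _ hy, h2 _ hz] at hyz
    exact he (add_left_cancel hyz)

/-- Strong extensions can be labelled. -/
theorem exists_extension (p : LabelledModel hK) {N : Type w} [L.Structure N]
    (f : p.carrier ↪[L] N) (hf : K.Strong f) :
    ∃ l : N → Ordinal.{w}, ∃ hl : Function.Injective l,
      IsLabelEmb p ⟨N, hK.cod_mem hf, l, hl⟩ f := by
  obtain ⟨l, hl, h⟩ := exists_label_extension f f.injective p.label p.label_injective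
  exact ⟨l, hl, hf, h⟩

variable (hK) in
theorem exists_of_mem {M : Type w} [L.Structure M] (hM : K.Mem M) :
    ∃ l : M → Ordinal.{w}, ∃ hl : Function.Injective l,
      (⟨M, hM, l, hl⟩ : LabelledModel hK).carrier = M := by
  refine ⟨fun y => Ordinal.typein (α := M) WellOrderingRel y, Ordinal.typein_injective _, rfl⟩

/-- Well-ordered chains of labelled models have least upper bounds. -/
theorem exists_limit {J : Type w} [LinearOrder J] [WellFoundedLT J] [Nonempty J]
    (m : J → LabelledModel hK) (hm : Monotone m) :
    ∃ q : LabelledModel hK, (∀ j, m j ≤ q) ∧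
      ∀ z : q.carrier, ∃ j, ∃ x : (m j).carrier, q.label z = (m j).label x := by
  choose f hf using fun (i j : J) (h : i ≤ j) => le_iff.1 (hm h)
  -- Commutation of the chosen embeddings is read off from the labels.
  have hdir : DirectedSystem (fun j => (m j).carrier) (fun i j h => f i j h) := by
    refine ⟨fun i x => ?_, fun k j i hij hjk x => ?_⟩
    · apply (m i).label_injective
      rw [(hf i i _).2]
    · apply (m _).label_injective
      rw [(hf _ _ _).2, (hf _ _ _).2, (hf _ _ _).2]
  let N : Type w := Language.DirectLimit (fun j => (m j).carrier) f
  let ι : ∀ j, (m j).carrier ↪[L] N := fun j => Language.DirectLimit.of L J _ f j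
  have hι : ∀ i j (h : i ≤ j) x, ι j (f i j h x) = ι i x := fun i j h x => DirectLimit.of_f
  have hex : ∀ z : N, ∃ i x, ι i x = z := fun z => Language.DirectLimit.exists_of z
  choose a b hab using hex
  let l : N → Ordinal.{w} := fun z => (m (a z)).label (b z)
  have hl : ∀ i x, l (ι i x) = (m i).label x := by
    intro i x
    obtain ⟨k, hk1, hk2⟩ := exists_ge_ge i (a (ι i x))
    have h : ι k (f _ k hk2 (b (ι i x))) = ι k (f i k hk1 x) := by
      rw [hι, hι]
      exact hab _
    have := congrArg (m k).label ((ι k).injective h)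
    rw [(hf _ _ _).2, (hf _ _ _).2] at this
    exact this
  have hl' : Function.Injective l := by
    intro y z hyz
    obtain ⟨k, hk1, hk2⟩ := exists_ge_ge (a y) (a z)
    rw [← hab y, ← hab z, ← hι _ _ hk1, ← hι _ _ hk2]
    congr 1
    apply (m k).label_injective
    rw [(hf _ _ _).2, (hf _ _ _).2]
    exact hyz
  have hchain := hK.iSup_chain (fun j => (ι j).toHom.range) (by
    intro i j hij
    have hi : (ι i).toHom.range = (f i j hij).toHom.range.map (ι j).toHom := by
      rw [← Hom.range_comp]
      congr 1
      ext x
      exact (hι i j hij x).symm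
    have hj : (ι j).toHom.range = (⊤ : L.Substructure _).map (ι j).toHom := Hom.range_eq_map _
    rw [hi, hj, hK.strongLE_map, hK.strongLE_top]
    exact (hf i j hij).1)
  have htop : (⨆ j, (ι j).toHom.range) = ⊤ := Language.DirectLimit.iSup_range_of_eq_top
  rw [htop] at hchain
  have hstr : ∀ j, K.Strong (ι j) := fun j => hK.strongLE_top.1 (hchain.1 j)
  obtain ⟨j₀⟩ := ‹Nonempty J›
  refine ⟨⟨N, hK.cod_mem (hstr j₀), l, hl'⟩, fun j => ⟨ι j, hstr j, hl j⟩, fun z => ?_⟩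
  exact ⟨a z, b z, rfl⟩

/-- The base `p` serves as the bound at the first stage of a recursion, where `J` is empty and there
is no limit to take. -/
theorem exists_upper_bound {J : Type w} [LinearOrder J] [WellFoundedLT J]
    (p : LabelledModel hK) (m : J → LabelledModel hK) (hm : Monotone m) (hp : ∀ j, p ≤ m j) :
    ∃ q : LabelledModel hK, p ≤ q ∧ ∀ j, m j ≤ q := by
  rcases isEmpty_or_nonempty J with hJ | ⟨⟨j⟩⟩
  · exact ⟨p, le_rfl, fun j => hJ.elim j⟩
  · have : Nonempty J := ⟨j⟩
    obtain ⟨q, hq, -⟩ := exists_limit m hm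
    exact ⟨q, (hp j).trans (hq j), hq⟩

/-- Extension of a labelled model in which a family of requirements is satisfied, where each
requirement is preserved by extensions and can be met in some extension. -/
theorem exists_extension_of_requirements {I : Type w} (p : LabelledModel hK)
    (R : I → LabelledModel hK → Prop) (hmono : ∀ i q r, q ≤ r → R i q → R i r)
    (hstep : ∀ i q, p ≤ q → ∃ r, q ≤ r ∧ R i r) :
    ∃ q, p ≤ q ∧ ∀ i, R i q := by
  obtain ⟨_, _⟩ := exists_wellFoundedLT I
  have : Nonempty (LabelledModel hK) := ⟨p⟩
  obtain ⟨m, hm, hQ⟩ := exists_monotone_of_step (J := I)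
    (fun j (_ : Set.Iio j → LabelledModel hK) q => p ≤ q ∧ R j q) (by
      intro j m hm hQ
      obtain ⟨q, hpq, hq⟩ := exists_upper_bound p m hm fun i => (hQ i).1
      obtain ⟨r, hqr, hr⟩ := hstep j q hpq
      exact ⟨r, fun i => (hq i).trans hqr, hpq.trans hqr, hr⟩)
  obtain ⟨q, hpq, hq⟩ := exists_upper_bound p m hm fun i => (hQ i).1
  exact ⟨q, hpq, fun i => hmono i _ _ (hq i) (hQ i).2⟩

end LabelledModel

/-! ### Existence of monster models. -/

theorem HasJEP.exists_embed (hJEP : K.HasJEP) {N₁ N₂ : Type w} [L.Structure N₁] [L.Structure N₂]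
    (h₁ : K.Mem N₁) (h₂ : K.Mem N₂) :
    ∃ (P : Type w) (_ : L.Structure P) (g₁ : N₁ ↪[L] P) (g₂ : N₂ ↪[L] P),
      K.Strong g₁ ∧ K.Strong g₂ := by
  obtain ⟨P, g₁, g₂, h⟩ := hJEP (asStr L N₁) (asStr L N₂) h₁ h₂
  exact ⟨P, P.str, g₁, g₂, h⟩

namespace IsAEC

variable (hK : K.IsAEC)
include hK

theorem amalgamate (hAP : K.HasAP) {M N₁ N₂ : Type w} [L.Structure M] [L.Structure N₁]
    [L.Structure N₂] (f₁ : M ↪[L] N₁) (f₂ : M ↪[L] N₂) (h₁ : K.Strong f₁) (h₂ : K.Strong f₂) :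
    ∃ (P : Type w) (_ : L.Structure P) (g₁ : N₁ ↪[L] P) (g₂ : N₂ ↪[L] P),
      K.Strong g₁ ∧ K.Strong g₂ ∧ ∀ x, g₁ (f₁ x) = g₂ (f₂ x) := by
  obtain ⟨P, g₁, g₂, h⟩ := hAP (asStr L M) (asStr L N₁) (asStr L N₂) f₁ f₂ (hK.dom_mem h₁) h₁ h₂
  exact ⟨P, P.str, g₁, g₂, h⟩

/-- Every member of the class has a strong extension universal in a given cardinality. -/
theorem exists_universal (hJEP : K.HasJEP) (κ : Cardinal.{w}) (p : LabelledModel hK) :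
    ∃ q, p ≤ q ∧ ∀ (N : Type w) [L.Structure N], K.Mem N → #N ≤ κ →
      ∃ f : N ↪[L] q.carrier, K.Strong f := by
  -- Every structure of size at most `κ` has a copy on a subset of `κ.out`, so it suffices to meet a
  -- set of requirements.
  obtain ⟨q, hpq, hq⟩ := LabelledModel.exists_extension_of_requirements
    (I := Σ s : Set κ.out, L.Structure s) p
    (fun i q => letI := i.2
      K.Mem i.1 → ∃ f : i.1 ↪[L] q.carrier, K.Strong f) (by
    rintro ⟨s, str⟩ q r ⟨g, hg⟩ h hs
    obtain ⟨f, hf⟩ := h hs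
    exact ⟨g.comp f, hK.comp hf hg.1⟩) (by
    rintro ⟨s, str⟩ q -
    by_cases hs : K.Mem s
    · obtain ⟨P, _, g₁, g₂, h₁, h₂⟩ := hJEP.exists_embed q.mem hs
      obtain ⟨l, hl, h⟩ := q.exists_extension g₁ h₁
      exact ⟨⟨P, hK.cod_mem h₁, l, hl⟩, ⟨g₁, h⟩, fun _ => ⟨g₂, h₂⟩⟩
    · exact ⟨q, le_rfl, fun h => absurd h hs⟩)
  refine ⟨q, hpq, fun N _ hN hcard => ?_⟩
  rw [← Cardinal.mk_out κ] at hcard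
  obtain ⟨e⟩ := hcard
  let e' : N ≃ Set.range e := Equiv.ofInjective e e.injective
  let _ : L.Structure (Set.range e) := e'.inducedStructure
  let E : N ≃[L] Set.range e := e'.inducedStructureEquiv
  obtain ⟨f, hf⟩ := hq ⟨Set.range e, inferInstance⟩ (hK.mem_equiv E hN)
  exact ⟨f.comp E.toEmbedding, hK.comp (hK.strong_equiv E hN) hf⟩

/-- Every member of the class has a strong extension to which all its partial strong
endomorphisms extend. -/
theorem exists_forth (hAP : K.HasAP) {M : Type w} [L.Structure M] (hM : K.Mem M) :
    ∃ (N : Type w) (_ : L.Structure N) (f : M ↪[L] N), K.Strong f ∧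
      ∀ (S : L.Substructure M) (e : S ↪[L] M), S ∈ K.strong (asStr L M) → K.Strong e →
        ∃ g : M ↪[L] N, K.Strong g ∧ ∀ x : S, g x = f (e x) := by
  obtain ⟨l, hl, -⟩ := LabelledModel.exists_of_mem hK hM
  let p : LabelledModel hK := ⟨M, hM, l, hl⟩
  -- Each requirement asserts its own embedding `f` of `M`, so as to mention only `q`; all these
  -- embeddings coincide in the end because they preserve labels. A single requirement is met by
  -- amalgamating `M` and `q` over `S`.
  obtain ⟨q, hpq, hq⟩ := LabelledModel.exists_extension_of_requirements
    (I := Σ S : L.Substructure M, (S ↪[L] M)) p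
    (fun i q => i.1 ∈ K.strong (asStr L M) → K.Strong i.2 →
      ∃ f : p.carrier ↪[L] q.carrier, LabelledModel.IsLabelEmb p q f ∧
        ∃ g : M ↪[L] q.carrier, K.Strong g ∧ ∀ x : i.1, g x = f (i.2 x)) (by
    rintro ⟨S, e⟩ q r ⟨t, ht⟩ h hS he
    obtain ⟨f, hf, g, hg, hgf⟩ := h hS he
    refine ⟨t.comp f, ⟨hK.comp hf.1 ht.1, fun x => ?_⟩, t.comp g, hK.comp hg ht.1, fun x => ?_⟩
    · rw [Embedding.comp_apply, ht.2, hf.2]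
    · rw [Embedding.comp_apply, Embedding.comp_apply, hgf]) (by
    rintro ⟨S, e⟩ q ⟨i, hi⟩
    by_cases hSe : S ∈ K.strong (asStr L M) ∧ K.Strong e
    · obtain ⟨hS, he⟩ := hSe
      obtain ⟨P, _, g₁, g₂, h₁, h₂, h⟩ := hK.amalgamate hAP S.subtype
        (show S ↪[L] q.carrier from i.comp e) (strong_subtype.2 hS) (hK.comp he hi.1)
      obtain ⟨l', hl', h'⟩ := q.exists_extension g₂ h₂
      refine ⟨⟨P, hK.cod_mem h₂, l', hl'⟩, ⟨g₂, h'⟩,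
        fun _ _ => ⟨g₂.comp i, ⟨hK.comp hi.1 h₂, fun x => ?_⟩, g₁, h₁, fun x => h x⟩⟩
      rw [Embedding.comp_apply, h'.2, hi.2]
    · exact ⟨q, le_rfl, fun hS he => absurd ⟨hS, he⟩ hSe⟩)
  obtain ⟨f, hf⟩ := hpq
  refine ⟨q.carrier, inferInstance, f, hf.1, fun S e hS he => ?_⟩
  obtain ⟨f', hf', g, hg, hgf⟩ := hq ⟨S, e⟩ hS he
  refine ⟨g, hg, fun x => ?_⟩
  rw [hgf]
  apply q.label_injective
  rw [hf'.2, hf.2]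

/-- `f : M → N` is a strong extension such that every isomorphism between strong submodels of
`M` extends to an isomorphism between strong submodels of `N` containing `M`. -/
def _root_.ConstructionPrinciple.AbstractClass.IsBackForth (K : AbstractClass.{w} L)
    {M N : Type w} [L.Structure M] [L.Structure N] (f : M ↪[L] N) : Prop :=
  K.Strong f ∧ ∀ (S T : L.Substructure M) (e : S ≃[L] T), S ∈ K.strong (asStr L M) →
    T ∈ K.strong (asStr L M) → ∃ g : N ≃ₚ[L] N, g.dom ∈ K.strong (asStr L N) ∧
      g.cod ∈ K.strong (asStr L N) ∧ f.toHom.range ≤ g.dom ∧ f.toHom.range ≤ g.cod ∧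
      ∀ x : S, ∃ h : f x ∈ g.dom, (g.toEquiv ⟨f x, h⟩ : N) = f (e x)

/-- Two forth steps: `e` extends to `g : M → N₁`, and then `f₁ ∘ g⁻¹` on the image of `g` extends to
`h : N₁ → N₂`. The required isomorphism is `f₂ ∘ h⁻¹`; its domain contains the image of `M` since `h
∘ g = f₂ ∘ f₁`. -/
theorem exists_backForth (hAP : K.HasAP) {M : Type w} [L.Structure M] (hM : K.Mem M) :
    ∃ (N : Type w) (_ : L.Structure N) (f : M ↪[L] N), K.IsBackForth f := by
  obtain ⟨N₁, _, f₁, hf₁, H₁⟩ := hK.exists_forth hAP hM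
  obtain ⟨N₂, _, f₂, hf₂, H₂⟩ := hK.exists_forth hAP (hK.cod_mem hf₁)
  refine ⟨N₂, inferInstance, f₂.comp f₁, hK.comp hf₁ hf₂, fun S T e hS hT => ?_⟩
  obtain ⟨g, hg, hge⟩ := H₁ S (T.subtype.comp e.toEmbedding) hS
    (hK.comp (hK.strong_equiv e (hK.dom_mem (strong_subtype.2 hS))) (strong_subtype.2 hT))
  obtain ⟨h, hh, hhg⟩ := H₂ g.toHom.range (f₁.comp g.equivRange.symm.toEmbedding) hg
    (hK.comp (hK.strong_equiv _ (hK.mem_equiv g.equivRange hM)) hf₁)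
  have hhg' : ∀ y, h (g y) = f₂ (f₁ y) := by
    intro y
    have := hhg (g.equivRange y)
    rw [Embedding.comp_apply] at this
    have h2 : g.equivRange.symm.toEmbedding (g.equivRange y) = y :=
      g.equivRange.symm_apply_apply y
    rw [h2] at this
    exact this
  refine ⟨⟨h.toHom.range, f₂.toHom.range, f₂.equivRange.comp h.equivRange.symm⟩, hh, hf₂, ?_, ?_,
    fun x => ⟨⟨g x, hhg' x⟩, ?_⟩⟩
  · rintro _ ⟨x, rfl⟩
    exact ⟨g x, hhg' x⟩
  · rintro _ ⟨x, rfl⟩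
    exact ⟨f₁ x, rfl⟩
  · have : (⟨(f₂.comp f₁) x, ⟨g x, hhg' x⟩⟩ : h.toHom.range) = h.equivRange (g x) :=
      Subtype.ext (hhg' x).symm
    change ((f₂.equivRange (h.equivRange.symm _) : f₂.toHom.range) : N₂) = _
    rw [this, Language.Equiv.symm_apply_apply, Embedding.equivRange_apply, hge]
    rfl

/-- Back-and-forth extensions, seen inside of a common strong extension. -/
theorem exists_partialEquiv_extension {A B M : Type w} [L.Structure A] [L.Structure B]
    [L.Structure M] {f : A ↪[L] B} (hf : K.IsBackForth f) {u : A ↪[L] M} {v : B ↪[L] M}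
    (hv : K.Strong v) (huv : ∀ x, v (f x) = u x) (g : M ≃ₚ[L] M)
    (hdom : g.dom ∈ K.strong (asStr L M)) (hcod : g.cod ∈ K.strong (asStr L M))
    (hdu : g.dom ≤ u.toHom.range) (hcu : g.cod ≤ u.toHom.range) :
    ∃ g' : M ≃ₚ[L] M, g ≤ g' ∧ g'.dom ∈ K.strong (asStr L M) ∧ g'.cod ∈ K.strong (asStr L M) ∧
      u.toHom.range ≤ g'.dom ∧ u.toHom.range ≤ g'.cod ∧
      g'.dom ≤ v.toHom.range ∧ g'.cod ≤ v.toHom.range := by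
  have hu : K.Strong u := strong_congr huv (hK.comp hf.1 hv)
  have aux : ∀ S : L.Substructure M, S ≤ u.toHom.range → ∃ S₀ : L.Substructure A,
      S₀.map u.toHom = S := by
    intro S hS
    refine ⟨S.comap u.toHom, le_antisymm Substructure.map_comap_le fun x hx => ?_⟩
    obtain ⟨y, rfl⟩ := hS hx
    exact ⟨y, hx, rfl⟩
  have hutop : u.toHom.range = (⊤ : L.Substructure A).map u.toHom := Hom.range_eq_map _
  have hvtop : v.toHom.range = (⊤ : L.Substructure B).map v.toHom := Hom.range_eq_map _
  have hdown : ∀ S : L.Substructure A, S.map u.toHom ∈ K.strong (asStr L M) →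
      S ∈ K.strong (asStr L A) := by
    intro S hS
    rw [← hK.strongLE_top, ← hK.strongLE_map u, ← hutop]
    refine hK.coherence (asStr L M) _ _ hS hu ?_
    rw [hutop]
    exact Substructure.monotone_map le_top
  have hup : ∀ S : L.Substructure B, S ∈ K.strong (asStr L B) →
      S.map v.toHom ∈ K.strong (asStr L M) := by
    intro S hS
    rw [← hK.strongLE_top, ← hK.strongLE_map v, ← hvtop] at hS
    exact hK.trans (asStr L M) _ _ hS hv
  have hrange : ∀ S : L.Substructure B, f.toHom.range ≤ S → u.toHom.range ≤ S.map v.toHom := by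
    rintro S hS _ ⟨x, rfl⟩
    exact ⟨f x, hS ⟨x, rfl⟩, huv x⟩
  have htop : ∀ S : L.Substructure B, S.map v.toHom ≤ v.toHom.range := by
    intro S
    rw [hvtop]
    exact Substructure.monotone_map le_top
  obtain ⟨S, T, e⟩ := g
  obtain ⟨S, rfl⟩ := aux S hdu
  obtain ⟨T, rfl⟩ := aux T hcu
  -- The isomorphism is read back in `A`, extended inside `B`, and carried to `M` along `v`.
  let e₀ : S ≃[L] T := (u.substructureEquivMap T).symm.comp (e.comp (u.substructureEquivMap S))
  obtain ⟨h, hhd, hhc, hrd, hrc, hh⟩ := hf.2 S T e₀ (hdown S hdom) (hdown T hcod)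
  refine ⟨⟨h.dom.map v.toHom, h.cod.map v.toHom, (v.substructureEquivMap h.cod).comp
    (h.toEquiv.comp (v.substructureEquivMap h.dom).symm)⟩, ?_, hup _ hhd, hup _ hhc,
    hrange _ hrd, hrange _ hrc, htop _, htop _⟩
  have hle : S.map u.toHom ≤ h.dom.map v.toHom := by
    rintro _ ⟨x, hx, rfl⟩
    exact ⟨f x, (hh ⟨x, hx⟩).1, huv x⟩
  refine ⟨hle, ?_⟩
  ext y
  obtain ⟨x, rfl⟩ := (u.substructureEquivMap S).surjective y
  obtain ⟨hx, hhx⟩ := hh x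
  have h1 : Substructure.inclusion hle (u.substructureEquivMap S x) =
      v.substructureEquivMap h.dom ⟨f x, hx⟩ := Subtype.ext (huv x).symm
  have h2 : u.substructureEquivMap T (e₀ x) = e (u.substructureEquivMap S x) :=
    (u.substructureEquivMap T).apply_symm_apply _
  change ((v.substructureEquivMap h.cod (h.toEquiv ((v.substructureEquivMap h.dom).symm
    (Substructure.inclusion hle (u.substructureEquivMap S x)))) : h.cod.map v.toHom) : M) =
    ((e (u.substructureEquivMap S x) : T.map u.toHom) : M)
  rw [h1, Language.Equiv.symm_apply_apply, ← h2, Embedding.substructureEquivMap_apply,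
    Embedding.substructureEquivMap_apply, hhx, huv]

/-- The union of a well-ordered chain of isomorphisms between strong submodels. -/
theorem exists_partialEquiv_limit {M : Type w} [L.Structure M] {J : Type w} [LinearOrder J]
    [WellFoundedLT J] [Nonempty J] (m : J → (M ≃ₚ[L] M)) (hm : Monotone m)
    (hdom : ∀ j, (m j).dom ∈ K.strong (asStr L M)) (hcod : ∀ j, (m j).cod ∈ K.strong (asStr L M)) :
    ∃ g : M ≃ₚ[L] M, (∀ j, m j ≤ g) ∧ g.dom = (⨆ j, (m j).dom) ∧ g.cod = (⨆ j, (m j).cod) ∧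
      g.dom ∈ K.strong (asStr L M) ∧ g.cod ∈ K.strong (asStr L M) := by
  have aux : ∀ S : J → L.Substructure M, Monotone S → (∀ j, S j ∈ K.strong (asStr L M)) →
      (⨆ j, S j) ∈ K.strong (asStr L M) := by
    intro S hS hmem
    rw [← hK.strongLE_top]
    exact (hK.iSup_chain S fun i j hij =>
      hK.coherence (asStr L M) _ _ (hmem i) (hmem j) (hS hij)).2 ⊤ fun i =>
        hK.strongLE_top.2 (hmem i)
  let F : J →o (M ≃ₚ[L] M) := ⟨m, hm⟩
  exact ⟨Language.DirectLimit.partialEquivLimit F, Language.DirectLimit.le_partialEquivLimit F,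
    rfl, rfl, aux _ (PartialEquiv.monotone_dom.comp hm) hdom,
    aux _ (PartialEquiv.monotone_cod.comp hm) hcod⟩

/-- Homogeneity of the union of a chain of back-and-forth extensions. -/
theorem exists_automorphism {J : Type w} [LinearOrder J] [WellFoundedLT J] [NoMaxOrder J]
    {M : Type w} [L.Structure M] (D E : J → L.Substructure M)
    (hDE : ∀ i j, i < j → D i ≤ E j) (htop : ⨆ j, D j = ⊤)
    (hext : ∀ j (g : M ≃ₚ[L] M), g.dom ∈ K.strong (asStr L M) → g.cod ∈ K.strong (asStr L M) →
      g.dom ≤ E j → g.cod ≤ E j → ∃ g' : M ≃ₚ[L] M, g ≤ g' ∧ g'.dom ∈ K.strong (asStr L M) ∧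
        g'.cod ∈ K.strong (asStr L M) ∧ E j ≤ g'.dom ∧ E j ≤ g'.cod ∧
        g'.dom ≤ D j ∧ g'.cod ≤ D j)
    {S T : L.Substructure M} (hS : S ∈ K.strong (asStr L M)) (hT : T ∈ K.strong (asStr L M))
    (e : S ≃[L] T) {j₀ : J} (hSD : S ≤ D j₀) (hTD : T ≤ D j₀) :
    ∃ π : M ≃[L] M, ∀ x : S, π x = e x := by
  let g₀ : M ≃ₚ[L] M := ⟨S, T, e⟩
  have : Nonempty (M ≃ₚ[L] M) := ⟨g₀⟩
  obtain ⟨j₁, hj₁⟩ := exists_gt j₀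
  have hne : Nonempty (Set.Ioi j₀) := ⟨⟨j₁, hj₁⟩⟩
  -- Before stage `j`, the union of the earlier isomorphisms lives inside `E j`, as `D i ≤ E j` for
  -- `i < j`; stage `j` makes its domain and codomain cover `E j`. The union of all stages is thus
  -- total and surjective.
  obtain ⟨m, hm, hQ⟩ := exists_monotone_of_step (P := M ≃ₚ[L] M) (J := Set.Ioi j₀)
    (fun j _ g => g₀ ≤ g ∧ g.dom ∈ K.strong (asStr L M) ∧ g.cod ∈ K.strong (asStr L M) ∧
      E j ≤ g.dom ∧ E j ≤ g.cod ∧ g.dom ≤ D j ∧ g.cod ≤ D j) (by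
    intro j m hm hQ
    obtain ⟨g, hg, hg₀, hgd, hgc, hgdE, hgcE⟩ : ∃ g : M ≃ₚ[L] M, (∀ i, m i ≤ g) ∧ g₀ ≤ g ∧
        g.dom ∈ K.strong (asStr L M) ∧ g.cod ∈ K.strong (asStr L M) ∧
        g.dom ≤ E j ∧ g.cod ≤ E j := by
      rcases isEmpty_or_nonempty (Set.Iio j) with hJ | hJ
      · exact ⟨g₀, fun i => hJ.elim i, le_rfl, hS, hT, hSD.trans (hDE _ _ j.2),
          hTD.trans (hDE _ _ j.2)⟩
      · obtain ⟨g, hg, hd, hc, hgd, hgc⟩ := hK.exists_partialEquiv_limit m hm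
          (fun i => (hQ i).2.1) (fun i => (hQ i).2.2.1)
        obtain ⟨i₀⟩ := hJ
        refine ⟨g, hg, (hQ i₀).1.trans (hg i₀), hgd, hgc, ?_, ?_⟩
        · rw [hd]
          exact iSup_le fun i => (hQ i).2.2.2.2.2.1.trans (hDE _ _ i.2)
        · rw [hc]
          exact iSup_le fun i => (hQ i).2.2.2.2.2.2.trans (hDE _ _ i.2)
    obtain ⟨g', hgg', h⟩ := hext j g hgd hgc hgdE hgcE
    exact ⟨g', fun i => (hg i).trans hgg', hg₀.trans hgg', h⟩)
  obtain ⟨g, hg, hd, hc, -, -⟩ := hK.exists_partialEquiv_limit m hm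
    (fun i => (hQ i).2.1) (fun i => (hQ i).2.2.1)
  have hcover : ∀ U : Set.Ioi j₀ → L.Substructure M, (∀ j : Set.Ioi j₀, E j ≤ U j) →
      ⨆ j, U j = ⊤ := by
    intro U hU
    rw [eq_top_iff, ← htop]
    refine iSup_le fun i => ?_
    obtain ⟨k, hk⟩ := exists_gt (max i j₀)
    have hk' : k ∈ Set.Ioi j₀ := (le_max_right _ _).trans_lt hk
    exact (hDE _ _ ((le_max_left _ _).trans_lt hk)).trans ((hU ⟨k, hk'⟩).trans (le_iSup U ⟨k, hk'⟩))
  rw [hcover _ fun j => (hQ j).2.2.2.1] at hd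
  rw [hcover _ fun j => (hQ j).2.2.2.2.1] at hc
  refine ⟨PartialEquiv.toEquivOfEqTop hd hc, fun x => ?_⟩
  have hle := (hQ ⟨j₁, hj₁⟩).1.trans (hg ⟨j₁, hj₁⟩)
  obtain ⟨h, h'⟩ := hle
  have h1 := DFunLike.congr_fun h' x
  have h2 := DFunLike.congr_fun (PartialEquiv.toEquivOfEqTop_toEmbedding hd hc) (x : M)
  rw [PartialEquiv.toEmbeddingOfEqTop_apply] at h2
  exact h2.trans h1

/-- Existence of monster models. -/
theorem exists_isMonster (hAP : K.HasAP) (hJEP : K.HasJEP) {κ : Cardinal.{w}} (hκ : κ.IsRegular)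
    {M₀ : Type w} [L.Structure M₀] (hM₀ : K.Mem M₀) :
    ∃ (M : Type w) (_ : L.Structure M), K.IsMonster κ (asStr L M) := by
  obtain ⟨l, hl, -⟩ := LabelledModel.exists_of_mem hK hM₀
  obtain ⟨p₀, -, huniv⟩ := hK.exists_universal hJEP κ ⟨M₀, hM₀, l, hl⟩
  have : Nonempty (LabelledModel hK) := ⟨p₀⟩
  let J : Type w := κ.ord.ToType
  have : NoMaxOrder J := Cardinal.noMaxOrder hκ.1
  have hJne : Nonempty J := by
    rw [Ordinal.nonempty_toType_iff]
    exact (Cardinal.ord_pos.2 (Cardinal.aleph0_pos.trans_le hκ.1)).ne'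
  -- Stage `j` is a back-and-forth extension of an upper bound `p` of the earlier stages. In the
  -- limit, the images of stage `j` and of its `p` play the roles of `D j` and `E j` in
  -- `exists_automorphism`.
  obtain ⟨m, hm, hQ⟩ := exists_monotone_of_step (P := LabelledModel hK) (J := J)
    (fun j m q => p₀ ≤ q ∧ ∃ p : LabelledModel hK, (∀ i, m i ≤ p) ∧
      ∃ f : p.carrier ↪[L] q.carrier, LabelledModel.IsLabelEmb p q f ∧ K.IsBackForth f) (by
    intro j m hm hQ
    obtain ⟨p, hp₀, hp⟩ := LabelledModel.exists_upper_bound p₀ m hm fun i => (hQ i).1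
    obtain ⟨N, _, f, hf⟩ := hK.exists_backForth hAP p.mem
    obtain ⟨l', hl', h⟩ := p.exists_extension f hf.1
    have hle : p ≤ (⟨N, hK.cod_mem hf.1, l', hl'⟩ : LabelledModel hK) := ⟨f, h⟩
    exact ⟨⟨N, hK.cod_mem hf.1, l', hl'⟩, fun i => (hp i).trans hle, hp₀.trans hle, p, hp,
      f, h, hf⟩)
  obtain ⟨q, hq, hcover⟩ := LabelledModel.exists_limit m hm
  choose hp₀ p hp f hf hbf using hQ
  choose v hv using fun j => LabelledModel.le_iff.1 (hq j)
  choose t ht using fun (i j : J) (hij : i < j) => LabelledModel.le_iff.1 (hp j ⟨i, hij⟩)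
  let u : ∀ j, (p j).carrier ↪[L] q.carrier := fun j => (v j).comp (f j)
  have hul : ∀ j x, q.label (u j x) = (p j).label x := by
    intro j x
    rw [Embedding.comp_apply, (hv j).2, (hf j).2]
  have hDE : ∀ i j, i < j → (v i).toHom.range ≤ (u j).toHom.range := by
    rintro i j hij _ ⟨x, rfl⟩
    refine ⟨t i j hij x, q.label_injective ?_⟩
    exact (hul j _).trans (((ht i j hij).2 x).trans ((hv i).2 x).symm)
  -- By regularity of `κ`, fewer than `κ` elements all appear by some stage.
  have hbound : ∀ S : L.Substructure q.carrier, #S < κ → ∃ j, S ≤ (v j).toHom.range := by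
    intro S hS
    choose a b hab using hcover
    let o : S → Ordinal.{w} := fun x => Ordinal.typein (α := J) (· < ·) (a x)
    have ho : ∀ x, o x < κ.ord := fun x => by
      have := Ordinal.typein_lt_type (α := J) (· < ·) (a x)
      rwa [Ordinal.type_toType] at this
    have hsup : ⨆ x, o x < κ.ord := by
      refine Ordinal.iSup_lt_of_lt_cof ?_ ho
      rwa [hκ.cof_ord]
    obtain ⟨j, hj⟩ := Ordinal.typein_surj (α := J) (· < ·) (o := ⨆ x, o x)
      (by rwa [Ordinal.type_toType])
    refine ⟨j, fun x hx => ?_⟩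
    have hle : a x ≤ j := by
      rw [← not_lt, ← Ordinal.typein_lt_typein (α := J) (· < ·), not_lt, hj]
      exact Ordinal.le_iSup o ⟨x, hx⟩
    obtain ⟨s, hs⟩ := LabelledModel.le_iff.1 (hm hle)
    refine ⟨s (b x), q.label_injective ?_⟩
    exact ((hv j).2 _).trans ((hs.2 _).trans (hab x).symm)
  have htop : ⨆ j, (v j).toHom.range = ⊤ := by
    rw [eq_top_iff]
    intro z _
    obtain ⟨j, x, hx⟩ := hcover z
    refine (le_iSup (fun j => (v j).toHom.range) j) ⟨x, q.label_injective ?_⟩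
    exact ((hv j).2 x).trans hx.symm
  obtain ⟨j₀⟩ := hJne
  refine ⟨q.carrier, inferInstance, q.mem, ?_, ?_⟩
  · intro N hN hcard
    obtain ⟨g, hg⟩ := huniv N hN hcard
    obtain ⟨h, hh⟩ := LabelledModel.le_iff.1 ((hp₀ j₀).trans (hq j₀))
    exact ⟨h.comp g, hK.comp hg hh.1⟩
  · intro S hS T hT hSκ hTκ e
    obtain ⟨j₁, h₁⟩ := hbound S hSκ
    obtain ⟨j₂, h₂⟩ := hbound T hTκ
    have hmono : ∀ i j, i ≤ j → (v i).toHom.range ≤ (v j).toHom.range := by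
      intro i j hij
      rcases hij.eq_or_lt with rfl | h
      · exact le_rfl
      · refine (hDE i j h).trans ?_
        rintro _ ⟨x, rfl⟩
        exact ⟨f j x, rfl⟩
    exact hK.exists_automorphism (fun j => (v j).toHom.range) (fun j => (u j).toHom.range) hDE htop
      (fun j g hd hc hdu hcu => hK.exists_partialEquiv_extension (hbf j) (hv j).1 (fun _ => rfl)
        g hd hc hdu hcu) hS hT e (j₀ := max j₁ j₂)
      (h₁.trans (hmono _ _ (le_max_left _ _))) (h₂.trans (hmono _ _ (le_max_right _ _)))

end IsAEC

end AbstractClass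

/-! ### Galois types and automorphisms of monster models. -/

namespace AbstractClass

open FirstOrder.Language CategoryTheory

variable {L : FirstOrder.Language.{0, 0}} {K : AbstractClass.{w} L}

namespace IsAEC

variable (hK : K.IsAEC)
include hK

/-- Transitivity is amalgamation over the extension that carries the middle element. Hence equality
of Galois types is witnessed by a single common extension. -/
theorem rel_equivalence (hAP : K.HasAP) (M : Bundled.{w} L.Structure) :
    Equivalence (PreType.Rel (K := K) (M := M)) where
  refl p := ⟨p.ext, Embedding.refl L _, Embedding.refl L _, hK.strong_refl (hK.cod_mem p.isStrong),
    hK.strong_refl (hK.cod_mem p.isStrong), fun _ => rfl, rfl⟩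
  symm := by
    rintro p q ⟨P, g, h, hg, hh, e, e'⟩
    exact ⟨P, h, g, hh, hg, fun x => (e x).symm, e'.symm⟩
  trans := by
    rintro p q r ⟨P, g, h, hg, hh, e, e'⟩ ⟨P', g', h', hg', hh', d, d'⟩
    obtain ⟨R, _, s, t, hs, ht, hst⟩ := hK.amalgamate hAP h g' hh hg'
    refine ⟨Bundled.of R, s.comp g, t.comp h', hK.comp hg hs, hK.comp hh' ht, fun x => ?_, ?_⟩
    · change s (g _) = t (h' _)
      rw [e, hst, d]
    · change s (g _) = t (h' _)
      rw [e', hst, d']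

theorem exists_amalgam_of_galoisType_eq (hAP : K.HasAP)
    {M M₁ M₂ : Type w} [L.Structure M] [L.Structure M₁] [L.Structure M₂]
    {m₁ : M ↪[L] M₁} {m₂ : M ↪[L] M₂} (hm₁ : K.Strong m₁) (hm₂ : K.Strong m₂) (x₁ : M₁) (x₂ : M₂)
    (htype : (Quot.mk _ ⟨asStr L M₁, m₁, hm₁, x₁⟩ : K.GaloisType (asStr L M)) =
      Quot.mk _ ⟨asStr L M₂, m₂, hm₂, x₂⟩) :
    ∃ (P : Type w) (_ : L.Structure P) (g : M₁ ↪[L] P) (h : M₂ ↪[L] P), K.Strong g ∧ K.Strong h ∧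
      (∀ x, g (m₁ x) = h (m₂ x)) ∧ g x₁ = h x₂ := by
  obtain ⟨P, g, h, H⟩ := (hK.rel_equivalence hAP _).eqvGen_iff.1 (Quot.eqvGen_exact htype)
  exact ⟨P, P.str, g, h, H⟩

omit hK in
theorem _root_.ConstructionPrinciple.AbstractClass.IsMonster.exists_automorphism
    {κ : Cardinal.{w}} {N Q : Type w} [L.Structure N] [L.Structure Q]
    (hN : K.IsMonster κ (asStr L N)) (hQ : #Q < κ) {k₁ k₂ : Q ↪[L] N} (hk₁ : K.Strong k₁)
    (hk₂ : K.Strong k₂) : ∃ f : N ≃[L] N, ∀ y, f (k₁ y) = k₂ y := by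
  have hcard : ∀ j : Q ↪[L] N, #j.toHom.range < κ := fun j => by
    rwa [← Cardinal.mk_congr j.equivRange.toEquiv]
  let e : k₁.toHom.range ≃[L] k₂.toHom.range := k₂.equivRange.comp k₁.equivRange.symm
  obtain ⟨f, hf⟩ := hN.homogeneous k₁.toHom.range hk₁ k₂.toHom.range hk₂ (hcard k₁) (hcard k₂) e
  refine ⟨f, fun y => ?_⟩
  have h1 : f (k₁ y) = ((e (k₁.equivRange y) : k₂.toHom.range) : N) := hf (k₁.equivRange y)
  have h2 : e (k₁.equivRange y) = k₂.equivRange y :=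
    congrArg k₂.equivRange (k₁.equivRange.symm_apply_apply y)
  exact h1.trans (congrArg Subtype.val h2)

/-- If two elements `x₁`, `x₂` of strong extensions of `M` have the same Galois type over `M`, then
in a strong extension of an amalgam of these extensions, chosen as a large monster model, there is
an automorphism over `M` that maps `x₂` to `x₁`. -/
theorem exists_monster_automorphism (hAP : K.HasAP) (hJEP : K.HasJEP)
    {M M₁ M₂ Q : Type w} [L.Structure M] [L.Structure M₁] [L.Structure M₂] [L.Structure Q]
    (m₁ : M ↪[L] M₁) (m₂ : M ↪[L] M₂) (hm₁ : K.Strong m₁) (hm₂ : K.Strong m₂) (x₁ : M₁) (x₂ : M₂)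
    (htype : (Quot.mk _ ⟨asStr L M₁, m₁, hm₁, x₁⟩ : K.GaloisType (asStr L M)) =
      Quot.mk _ ⟨asStr L M₂, m₂, hm₂, x₂⟩)
    (i₁ : M₁ ↪[L] Q) (i₂ : M₂ ↪[L] Q) (hi₁ : K.Strong i₁) (hi₂ : K.Strong i₂)
    (hi : ∀ x, i₁ (m₁ x) = i₂ (m₂ x)) (κ₀ : Cardinal.{w}) :
    ∃ κ, κ₀ ≤ κ ∧ ∃ (N : Type w) (_ : L.Structure N) (k : Q ↪[L] N) (f : N ≃[L] N),
      K.IsMonster κ (asStr L N) ∧ K.Strong k ∧ (∀ x, f (k (i₁ (m₁ x))) = k (i₁ (m₁ x))) ∧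
      f (k (i₂ x₂)) = k (i₁ x₁) := by
  obtain ⟨P, _, g, h, hg, hh, e, e'⟩ := hK.exists_amalgam_of_galoisType_eq hAP hm₁ hm₂ x₁ x₂ htype
  -- `P₂` will contain two copies of `Q`, via `t ∘ r` and `q₂`, that agree on `M`, with `x₁` of the
  -- first copy equal to `x₂` of the second. An automorphism moving the first copy to the second
  -- then does what is required.
  obtain ⟨P₁, _, r, s, hr, hs, hrs⟩ := hK.amalgamate hAP i₁ g hi₁ hg
  obtain ⟨P₂, _, t, q₂, ht, hq₂, htq⟩ := hK.amalgamate hAP (s.comp h) i₂ (hK.comp hh hs) hi₂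
  let κ := Order.succ (max κ₀ (max #P₂ ℵ₀))
  have hκ : κ.IsRegular :=
    Cardinal.isRegular_succ ((le_max_right _ _).trans (le_max_right _ _))
  have hκP : #P₂ < κ := Order.lt_succ_of_le ((le_max_left _ _).trans (le_max_right _ _))
  obtain ⟨N, _, hN⟩ := hK.exists_isMonster hAP hJEP hκ (hK.cod_mem ht)
  obtain ⟨k, hk⟩ : ∃ k : P₂ ↪[L] N, K.Strong k := hN.universal (asStr L P₂) (hK.cod_mem ht) hκP.le
  let k₁ : Q ↪[L] N := k.comp (t.comp r)
  let k₂ : Q ↪[L] N := k.comp q₂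
  have hk₁ : K.Strong k₁ := hK.comp (hK.comp hr ht) hk
  have hk₂ : K.Strong k₂ := hK.comp hq₂ hk
  obtain ⟨f, hf⟩ := hN.exists_automorphism
    ((Cardinal.mk_le_of_injective q₂.injective).trans_lt hκP) hk₁ hk₂
  refine ⟨κ, (le_max_left _ _).trans (Order.le_succ _), N, inferInstance, k₂, f, hN, hk₂,
    fun x => ?_, ?_⟩
  · have : k₁ (i₁ (m₁ x)) = k₂ (i₁ (m₁ x)) := by
      change k (t (r _)) = k (q₂ _)
      rw [hrs, hi, ← htq, e x]
      rfl
    conv_lhs => rw [← this]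
    exact hf _
  · have : k₁ (i₁ x₁) = k₂ (i₂ x₂) := by
      change k (t (r _)) = k (q₂ _)
      rw [hrs, ← htq, e']
      rfl
    rw [← this]
    exact hf _

end IsAEC

end AbstractClass

/-! ### Free objects and free bases in a variety. -/

section Variety

variable {W : Set (FreeGroup ℕ)}

theorem map_freeGroup_lift {ι : Type w} {G H : Type*} [Group G] [Group H] (φ : G →* H) (v : ι → G)
    (r : FreeGroup ι) : φ (FreeGroup.lift v r) = FreeGroup.lift (fun i => φ (v i)) r := by
  have : φ.comp (FreeGroup.lift v) = FreeGroup.lift (fun i => φ (v i)) := by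
    ext i
    simp
  exact DFunLike.congr_fun this r

theorem InVariety.of_injective {G : Type u} {H : Type w} [Group G] [Group H] (hG : InVariety W G)
    (φ : H →* G) (hφ : Function.Injective φ) : InVariety W H := by
  intro r hr v
  apply hφ
  rw [map_freeGroup_lift, hG r hr, map_one]

theorem InVariety.subgroup {G : Type u} [Group G] (hG : InVariety W G) (A : Subgroup G) :
    InVariety W A :=
  hG.of_injective A.subtype A.subtype_injective

variable (W) in
/-- The subgroup of values of the laws in a free group. -/
def verbalSubgroup (ι : Type u) : Subgroup (FreeGroup ι) :=
  Subgroup.normalClosure {x | ∃ r ∈ W, ∃ v : ℕ → FreeGroup ι, x = FreeGroup.lift v r}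

instance (ι : Type u) : (verbalSubgroup W ι).Normal := Subgroup.normalClosure_normal

variable (W) in
/-- The free object of the variety on a type. -/
abbrev VFree (ι : Type u) : Type u := FreeGroup ι ⧸ verbalSubgroup W ι

variable (W) in
/-- The generators of the free object of the variety. -/
def vof {ι : Type u} (i : ι) : VFree W ι := QuotientGroup.mk' _ (FreeGroup.of i)

theorem inVariety_vfree (ι : Type u) : InVariety W (VFree W ι) := by
  intro r hr v
  choose v' hv' using fun i => QuotientGroup.mk'_surjective (verbalSubgroup W ι) (v i)
  obtain rfl : (fun i => QuotientGroup.mk' _ (v' i)) = v := funext hv'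
  rw [← map_freeGroup_lift]
  exact (QuotientGroup.eq_one_iff _).2 (Subgroup.subset_normalClosure ⟨r, hr, v', rfl⟩)

namespace IsFreeBasis

variable {ι : Type w} {G : Type u} [Group G] {b : ι → G}

/-- The homomorphism with given values on a free basis. -/
noncomputable def lift (hb : IsFreeBasis W b) {H : Type u} [Group H] (hH : InVariety W H)
    (f : ι → H) : G →* H :=
  (hb.2 H hH f).choose

@[simp]
theorem lift_apply (hb : IsFreeBasis W b) {H : Type u} [Group H] (hH : InVariety W H)
    (f : ι → H) (i : ι) : hb.lift hH f (b i) = f i :=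
  (hb.2 H hH f).choose_spec.1 i

theorem hom_ext (hb : IsFreeBasis W b) {H : Type u} [Group H] (hH : InVariety W H)
    {φ ψ : G →* H} (h : ∀ i, φ (b i) = ψ (b i)) : φ = ψ :=
  (hb.2 H hH fun i => ψ (b i)).unique h fun _ => rfl

/-- The map `G → S ≤ G` given by the universal property is the identity on the basis, hence
everywhere, by uniqueness. -/
theorem closure_range (hb : IsFreeBasis W b) : Subgroup.closure (Set.range b) = ⊤ := by
  rw [eq_top_iff]
  intro g _
  let S := Subgroup.closure (Set.range b)
  let φ : G →* S := hb.lift (hb.1.subgroup S) fun i => ⟨b i, Subgroup.subset_closure ⟨i, rfl⟩⟩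
  have : S.subtype.comp φ = MonoidHom.id G := by
    apply hb.hom_ext hb.1
    intro i
    simp [φ]
  have h : ((φ g : S) : G) = g := DFunLike.congr_fun this g
  rw [← h]
  exact (φ g).2

theorem of_closure (hG : InVariety W G) (hb : Subgroup.closure (Set.range b) = ⊤)
    (h : ∀ (H : Type u) [Group H], InVariety W H → ∀ f : ι → H, ∃ φ : G →* H, ∀ i, φ (b i) = f i) :
    IsFreeBasis W b := by
  refine ⟨hG, fun H _ hH f => ?_⟩
  obtain ⟨φ, hφ⟩ := h H hH f
  refine ⟨φ, hφ, fun ψ hψ => MonoidHom.eq_of_eqOn_dense hb ?_⟩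
  rintro _ ⟨i, rfl⟩
  rw [hφ, hψ]

theorem reindex (hb : IsFreeBasis W b) {κ : Type*} (e : κ ≃ ι) :
    IsFreeBasis W (fun k => b (e k)) := by
  refine of_closure hb.1 ?_ fun H _ hH f => ⟨hb.lift hH fun i => f (e.symm i), fun k => by simp⟩
  rw [← hb.closure_range]
  congr 1
  exact e.surjective.range_comp b

theorem reindex_bijective (hb : IsFreeBasis W b) {κ : Type*} {c : κ → G} (τ : κ → ι)
    (hτ : Function.Bijective τ) (hc : ∀ k, b (τ k) = c k) : IsFreeBasis W c := by
  have := hb.reindex (Equiv.ofBijective τ hτ)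
  rwa [show (fun k => b (Equiv.ofBijective τ hτ k)) = c from funext hc] at this

theorem map_equiv (hb : IsFreeBasis W b) {H : Type u} [Group H] (e : G ≃* H) :
    IsFreeBasis W (fun i => e (b i)) := by
  refine ⟨hb.1.of_injective e.symm.toMonoidHom e.symm.injective, fun K _ hK f => ?_⟩
  refine ⟨(hb.lift hK f).comp e.symm.toMonoidHom, fun i => by simp, fun ψ hψ => ?_⟩
  have : ψ.comp e.toMonoidHom = hb.lift hK f := hb.hom_ext hK fun i => by simp [hψ]
  rw [← this]
  ext x
  simp

theorem injective (hb : IsFreeBasis W b)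
    (hW : ∃ (G : Type u) (_ : Group G), InVariety W G ∧ Nontrivial G) : Function.Injective b := by
  classical
  obtain ⟨H, _, hH, hn⟩ := hW
  obtain ⟨x, hx⟩ := exists_ne (1 : H)
  intro i j hij
  by_contra hne
  have h1 := hb.lift_apply hH (fun k => if k = i then x else 1) i
  have h2 := hb.lift_apply hH (fun k => if k = i then x else 1) j
  rw [hij, h2, if_neg (Ne.symm hne), if_pos rfl] at h1
  exact hx h1.symm

theorem subtype_range (hb : IsFreeBasis W b) (hinj : Function.Injective b) :
    IsFreeBasis W (fun x : Set.range b => (x : G)) := by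
  refine hb.reindex_bijective (fun x => (Equiv.ofInjective b hinj).symm x)
    (Equiv.ofInjective b hinj).symm.bijective fun x => ?_
  exact Equiv.apply_ofInjective_symm hinj x

theorem isFree (hb : IsFreeBasis W b) (hinj : Function.Injective b) : IsFree W G :=
  ⟨Set.range b, hb.subtype_range hinj⟩

theorem isFreeInf [Infinite ι] (hb : IsFreeBasis W b) (hinj : Function.Injective b) :
    IsFreeInf W G :=
  ⟨Set.range b, Set.infinite_range_of_injective hinj, hb.subtype_range hinj⟩

/-- A part of a free basis is a free basis of the subgroup that it generates. -/
theorem restrict (hb : IsFreeBasis W b) (s : Set ι) :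
    IsFreeBasis W (fun i : s => (⟨b i, Subgroup.subset_closure ⟨i, i.2, rfl⟩⟩ :
      Subgroup.closure (b '' s))) := by
  classical
  refine of_closure (hb.1.subgroup _) ?_ fun H _ hH f =>
    ⟨(hb.lift hH fun i => if h : i ∈ s then f ⟨i, h⟩ else 1).comp (Subgroup.subtype _),
      fun i => by simp⟩
  rw [← Subgroup.closure_closure_coe_preimage (k := b '' s)]
  congr 1
  ext x
  constructor
  · rintro ⟨i, rfl⟩
    exact ⟨i, i.2, rfl⟩
  · rintro ⟨i, hi, h⟩
    exact ⟨⟨i, hi⟩, Subtype.ext h⟩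

theorem isFreeProduct (hb : IsFreeBasis W b) (s : Set ι) :
    IsFreeProduct W (Subgroup.closure (b '' s)).subtype (Subgroup.closure (b '' sᶜ)).subtype := by
  classical
  refine ⟨hb.1, fun H _ hH f g => ?_⟩
  refine ⟨hb.lift hH fun i => if h : i ∈ s then f ⟨b i, Subgroup.subset_closure ⟨i, h, rfl⟩⟩
    else g ⟨b i, Subgroup.subset_closure ⟨i, h, rfl⟩⟩, ⟨?_, ?_⟩, ?_⟩
  · apply (hb.restrict s).hom_ext hH
    intro i
    simp
  · apply (hb.restrict sᶜ).hom_ext hH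
    intro i
    have : i.1 ∉ s := i.2
    simp [this]
  · rintro ψ ⟨rfl, rfl⟩
    apply hb.hom_ext hH
    intro i
    by_cases h : i ∈ s <;> simp

theorem isFreeFactor (hb : IsFreeBasis W b) (hinj : Function.Injective b) (s : Set ι) :
    IsFreeFactor W (Subgroup.closure (b '' s)) := by
  have aux : ∀ t : Set ι, IsFree W (Subgroup.closure (b '' t)) := fun t =>
    (hb.restrict t).isFree fun i j hij => Subtype.ext (hinj (congrArg Subtype.val hij))
  exact ⟨hb.isFree hinj, aux s, _, aux sᶜ, hb.isFreeProduct s⟩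

/-- Replacement of the part of a free basis that comes from a free factor. -/
theorem replace {B : Type u} [Group B] {ι' κ : Type*} {b : ι → B} {b' : ι' → B}
    (hb : IsFreeBasis W b) (hb' : IsFreeBasis W b') {β : B →* G} {y : κ → G}
    (h : IsFreeBasis W (Sum.elim (fun i => β (b i)) y)) :
    IsFreeBasis W (Sum.elim (fun i => β (b' i)) y) := by
  refine ⟨h.1, fun H _ hH f => ?_⟩
  -- Values prescribed on `b'` determine `ψ` on `B`, and so values on `b`, to which the given basis
  -- of `G` applies.
  let ψ : B →* H := hb'.lift hH fun i => f (Sum.inl i)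
  let φ : G →* H := h.lift hH (Sum.elim (fun i => ψ (b i)) fun k => f (Sum.inr k))
  have h1 : ∀ i, φ (β (b i)) = ψ (b i) := fun i => h.lift_apply hH _ (Sum.inl i)
  have h2 : ∀ k, φ (y k) = f (Sum.inr k) := fun k => h.lift_apply hH _ (Sum.inr k)
  have hφψ : φ.comp β = ψ := hb.hom_ext hH h1
  have h3 : ∀ i, φ (β (b' i)) = f (Sum.inl i) := fun i => by
    have := DFunLike.congr_fun hφψ (b' i)
    rw [MonoidHom.comp_apply] at this
    rw [this]
    exact hb'.lift_apply hH _ i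
  refine ⟨φ, fun i => ?_, fun φ' hφ' => ?_⟩
  · rcases i with i | k
    · exact h3 i
    · exact h2 k
  · have h4 : φ'.comp β = φ.comp β := hb'.hom_ext hH fun i => (hφ' (Sum.inl i)).trans (h3 i).symm
    apply h.hom_ext hH
    rintro (i | k)
    · exact DFunLike.congr_fun h4 (b i)
    · exact (hφ' (Sum.inr k)).trans (h2 k).symm

end IsFreeBasis

theorem isFreeBasis_vof (ι : Type u) : IsFreeBasis W (vof W : ι → VFree W ι) := by
  refine ⟨inVariety_vfree ι, fun H _ hH f => ?_⟩
  refine ⟨QuotientGroup.lift _ (FreeGroup.lift f) ?_, fun i => ?_, fun ψ hψ => ?_⟩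
  · intro x hx
    have hle : verbalSubgroup W ι ≤ (FreeGroup.lift f).ker := by
      apply Subgroup.normalClosure_le_normal
      rintro _ ⟨r, hr, v, rfl⟩
      change FreeGroup.lift f _ = 1
      rw [map_freeGroup_lift, hH r hr]
    exact hle hx
  · change FreeGroup.lift f (FreeGroup.of i) = f i
    simp
  · apply QuotientGroup.monoidHom_ext
    ext i
    exact (hψ i).trans (by simp)

theorem IsFreeProduct.isFreeBasis {B C D : Type u} [Group B] [Group C] [Group D] {β : B →* D}
    {γ : C →* D} (h : IsFreeProduct W β γ) {ι κ : Type*} {b : ι → B} {c : κ → C}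
    (hb : IsFreeBasis W b) (hc : IsFreeBasis W c) :
    IsFreeBasis W (Sum.elim (fun i => β (b i)) fun k => γ (c k)) := by
  refine ⟨h.1, fun H _ hH f => ?_⟩
  obtain ⟨φ, ⟨h1, h2⟩, -⟩ := h.2 H hH (hb.lift hH fun i => f (Sum.inl i))
    (hc.lift hH fun k => f (Sum.inr k))
  have h1' : ∀ i, φ (β (b i)) = f (Sum.inl i) := fun i =>
    (DFunLike.congr_fun h1 (b i)).trans (hb.lift_apply hH _ i)
  have h2' : ∀ k, φ (γ (c k)) = f (Sum.inr k) := fun k =>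
    (DFunLike.congr_fun h2 (c k)).trans (hc.lift_apply hH _ k)
  refine ⟨φ, ?_, fun ψ hψ => ?_⟩
  · rintro (i | k)
    · exact h1' i
    · exact h2' k
  · refine (h.2 H hH (φ.comp β) (φ.comp γ)).unique ⟨?_, ?_⟩ ⟨rfl, rfl⟩
    · exact hb.hom_ext hH fun i => (hψ (Sum.inl i)).trans (h1' i).symm
    · exact hc.hom_ext hH fun k => (hψ (Sum.inr k)).trans (h2' k).symm

theorem IsFreeFactor.exists_basis {G : Type u} [Group G] {A : Subgroup G} (h : IsFreeFactor W A)
    {ι : Type*} {a : ι → A} (ha : IsFreeBasis W a) :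
    ∃ (Z : Type u) (z : Z → G), IsFreeBasis W (Sum.elim (fun i => (a i : G)) z) := by
  obtain ⟨-, -, C, ⟨X, hX⟩, hC⟩ := h
  exact ⟨X, fun x => (x : C), hC.isFreeBasis ha hX⟩

end Variety

/-! ### Homomorphisms of groups as embeddings of structures -/

/-- An injective homomorphism, as an embedding of first-order structures. -/
def homEmb {G : Type u} {H : Type w} [Group G] [Group H] (φ : G →* H)
    (hφ : Function.Injective φ) : G ↪[groupLang] H where
  toFun := φ
  inj' := hφ
  map_fun' := fun {_} f x => by
    match f, x with
    | GroupFunc.one, _ => exact φ.map_one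
    | GroupFunc.inv, x => exact φ.map_inv (x 0)
    | GroupFunc.mul, x => exact φ.map_mul (x 0) (x 1)
  map_rel' := fun {_} r _ => nomatch r

theorem range_homEmb {G : Type u} {H : Type w} [Group G] [Group H] (φ : G →* H)
    (hφ : Function.Injective φ) : (homEmb φ hφ).toHom.range = toSub φ.range := by
  ext x
  rw [FirstOrder.Language.Hom.mem_range]
  exact MonoidHom.mem_range.symm

/-- An isomorphism of groups, as an isomorphism of first-order structures. -/
def mulEquivEquiv {G : Type u} {H : Type w} [Group G] [Group H] (e : G ≃* H) :
    G ≃[groupLang] H where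
  toEquiv := e.toEquiv
  map_fun' := (homEmb e.toMonoidHom e.injective).map_fun'
  map_rel' := fun {_} r _ => nomatch r

/-! ### Quantifier-free definable closure in groups -/

section Definability

open FirstOrder.Language

/-- Products of terms. -/
def mulTerm {α : Type*} (s t : groupLang.Term α) : groupLang.Term α :=
  Functions.apply₂ (L := groupLang) GroupFunc.mul s t

theorem realize_mulTerm {α : Type*} {G : Type u} [Group G] (v : α → G) (s t : groupLang.Term α) :
    (mulTerm s t).realize v = s.realize v * t.realize v :=
  Term.realize_functions_apply₂ (L := groupLang) (f := GroupFunc.mul)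

/-- Inverses of terms. -/
def invTerm {α : Type*} (s : groupLang.Term α) : groupLang.Term α :=
  Functions.apply₁ (L := groupLang) GroupFunc.inv s

theorem realize_invTerm {α : Type*} {G : Type u} [Group G] (v : α → G) (s : groupLang.Term α) :
    (invTerm s).realize v = (s.realize v)⁻¹ :=
  Term.realize_functions_apply₁ (L := groupLang) (f := GroupFunc.inv)

theorem isQFDefinable_of_equation {G : Type u} [Group G] {T : Set G} {x : G}
    (s t : groupLang.Term (T ⊕ Unit))
    (h : ∀ y, s.realize (Sum.elim (fun t : T => (t : G)) fun _ => y) =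
      t.realize (Sum.elim (fun t : T => (t : G)) fun _ => y) ↔ y = x) :
    IsQFDefinable groupLang T x := by
  refine ⟨s.equal t, (BoundedFormula.IsAtomic.equal _ _).isQF, fun y => ?_⟩
  rw [Formula.realize_equal]
  exact h y

variable {G : Type u} [Group G] {T : Set G}

theorem isQFDefinable_mul {x y : G} (hx : x ∈ T) (hy : y ∈ T) :
    IsQFDefinable groupLang T (x * y) :=
  isQFDefinable_of_equation (Term.var (Sum.inr ()))
    (mulTerm (Term.var (Sum.inl ⟨x, hx⟩)) (Term.var (Sum.inl ⟨y, hy⟩))) fun z => by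
      rw [realize_mulTerm]
      exact Iff.rfl

theorem isQFDefinable_inv {x : G} (hx : x ∈ T) : IsQFDefinable groupLang T x⁻¹ :=
  isQFDefinable_of_equation (Term.var (Sum.inr ()))
    (invTerm (Term.var (Sum.inl ⟨x, hx⟩))) fun z => by
      rw [realize_invTerm]
      exact Iff.rfl

theorem isQFDefinable_of_sq {x : G} (hx : x * x ∈ T) (h : ∀ y, y * y = x * x → y = x) :
    IsQFDefinable groupLang T x :=
  isQFDefinable_of_equation
    (mulTerm (Term.var (Sum.inr ())) (Term.var (Sum.inr ())))
    (Term.var (Sum.inl ⟨x * x, hx⟩)) fun z => by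
      rw [realize_mulTerm]
      refine ⟨h z, ?_⟩
      rintro rfl
      rfl

theorem realize_congr_of_freeVar {L : FirstOrder.Language} {M α : Type*} [L.Structure M]
    [DecidableEq α] {φ : L.Formula α} {v v' : α → M} (h : ∀ a ∈ φ.freeVarFinset, v a = v' a) :
    φ.Realize v ↔ φ.Realize v' :=
  (BoundedFormula.realize_restrictFreeVar (φ := φ) (f := id) (v := fun a => v a) v
    fun _ => rfl).symm.trans (BoundedFormula.realize_restrictFreeVar v' fun a => h a a.2)

/-- A set is closed under quantifier-free definability when the elements outside of it are moved
by automorphisms that fix arbitrary finite parts of it. -/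
theorem dclQF_subset_of_automorphisms {S T : Set G} (hST : S ⊆ T)
    (h : ∀ F : Finset G, (F : Set G) ⊆ T → ∀ x ∉ T, ∃ σ : G ≃* G, (∀ y ∈ F, σ y = y) ∧ σ x ≠ x) :
    dclQF groupLang S ⊆ T := by
  classical
  intro x hx
  refine hx T ⟨hST, fun z hz => ?_⟩
  by_contra hzT
  obtain ⟨φ, -, hφ⟩ := hz
  -- `F` consists of the parameters occurring in `φ`; an automorphism fixing them preserves the
  -- solution set of `φ`.
  let F : Finset G := φ.freeVarFinset.biUnion fun p => Sum.elim (fun t : T => {(t : G)})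
    (fun _ => ∅) p
  obtain ⟨σ, hσ, hσz⟩ := h F (by
    intro y hy
    simp only [F, Finset.coe_biUnion, Set.mem_iUnion] at hy
    obtain ⟨p, -, hp⟩ := hy
    rcases p with t | _
    · simp only [Sum.elim_inl, Finset.coe_singleton, Set.mem_singleton_iff] at hp
      rw [hp]
      exact t.2
    · simp at hp) z hzT
  apply hσz
  rw [← hφ]
  have hz : φ.Realize (Sum.elim (fun t : T => (t : G)) fun _ => z) := (hφ z).2 rfl
  rw [← StrongHomClass.realize_formula (mulEquivEquiv σ)] at hz
  refine (realize_congr_of_freeVar fun p hp => ?_).1 hz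
  rcases p with t | _
  · refine hσ t ?_
    rw [Finset.mem_biUnion]
    exact ⟨_, hp, Finset.mem_singleton_self _⟩
  · rfl

end Definability

/-! ### Abelian quotients of free objects. -/

section Variety

variable {W : Set (FreeGroup ℕ)}

/-- The variety contains all abelian groups, since its free object of rank one is infinite. -/
theorem IsTorsionFreeVariety.inVariety_of_comm (hW : IsTorsionFreeVariety.{u} W) (A : Type w)
    [CommGroup A] : InVariety W A := by
  have hint : InVariety W (Multiplicative ℤ) := by
    obtain ⟨⟨H, _, hH, hn⟩, htf⟩ := id hW
    obtain ⟨h, hh⟩ := exists_ne (1 : H)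
    have hb := isFreeBasis_vof (W := W) PUnit.{u + 1}
    let x := vof W PUnit.unit.{u + 1}
    have hx : x ≠ 1 := by
      intro hx
      have := hb.lift_apply hH (fun _ => h) PUnit.unit
      change hb.lift hH (fun _ => h) x = h at this
      rw [hx, map_one] at this
      exact hh this.symm
    have hfree := hb.isFree (hb.injective hW.1)
    have hord : ¬ IsOfFinOrder x := by
      rw [isOfFinOrder_iff_pow_eq_one]
      rintro ⟨n, hn, h⟩
      exact hx (htf _ hfree x n hn h)
    refine hb.1.of_injective (zpowersHom _ x) ?_
    intro m n hmn
    exact injective_zpow_iff_not_isOfFinOrder.2 hord hmn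
  intro r hr v
  -- A law holds in `ℤ`, so its image in the free abelian group vanishes coordinatewise; every
  -- evaluation in `A` factors through that image.
  let φ : FreeGroup ℕ →* Multiplicative (ℕ →₀ ℤ) :=
    FreeGroup.lift fun i => Multiplicative.ofAdd (Finsupp.single i 1)
  have hφ : φ r = 1 := by
    apply Multiplicative.toAdd.injective
    ext i
    have := hint r hr fun j => Multiplicative.ofAdd ((Finsupp.single j (1 : ℤ)) i)
    have h2 := map_freeGroup_lift (AddMonoidHom.toMultiplicative (Finsupp.applyAddHom i))
      (fun j => Multiplicative.ofAdd (Finsupp.single j (1 : ℤ))) r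
    exact h2.trans this
  let ψ : Multiplicative (ℕ →₀ ℤ) →* A := AddMonoidHom.toMultiplicativeLeft
    (Finsupp.liftAddHom fun i => zmultiplesHom (Additive A) (Additive.ofMul (v i)))
  have h := map_freeGroup_lift ψ (fun j => Multiplicative.ofAdd (Finsupp.single j (1 : ℤ))) r
  have hv : (fun j => ψ (Multiplicative.ofAdd (Finsupp.single j (1 : ℤ)))) = v := by
    funext j
    change Additive.toMul (Finsupp.liftAddHom _ (Finsupp.single j (1 : ℤ))) = v j
    rw [Finsupp.liftAddHom_apply_single]
    simp
  rw [hv] at h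
  rw [← h]
  exact (congrArg ψ hφ).trans (map_one ψ)

/-- In a free object of a torsion-free variety, the successive square roots of an element
die in every abelian quotient. -/
theorem IsFree.map_eq_one_of_sqrt {C : Type u} [Group C] (hC : IsFree W C)
    (hW : IsTorsionFreeVariety.{u} W) {c : ℕ → C} (hc : ∀ i, c i = c (i + 1) ^ 2)
    {A : Type u} [CommGroup A] (ψ : C →* A) : ψ (c 0) = 1 := by
  obtain ⟨X, hX⟩ := hC
  let Φ : C →* Multiplicative (X →₀ ℤ) := hX.lift (hW.inVariety_of_comm _)
    fun x => Multiplicative.ofAdd (Finsupp.single x 1)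
  let Λ : Multiplicative (X →₀ ℤ) →* A := AddMonoidHom.toMultiplicativeLeft
    (Finsupp.liftAddHom fun x => zmultiplesHom (Additive A) (Additive.ofMul (ψ x)))
  have hΛ : Λ.comp Φ = ψ := by
    apply hX.hom_ext (hW.inVariety_of_comm _)
    intro x
    rw [MonoidHom.comp_apply, hX.lift_apply]
    change Additive.toMul (Finsupp.liftAddHom _ (Finsupp.single x (1 : ℤ))) = ψ x
    rw [Finsupp.liftAddHom_apply_single]
    simp
  have hpow : ∀ i, c 0 = c i ^ 2 ^ i := by
    intro i
    induction i with
    | zero => simp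
    | succ i ih => rw [ih, hc i, ← pow_mul, pow_succ']
  have hΦ : Φ (c 0) = 1 := by
    apply Multiplicative.toAdd.injective
    ext x
    set m := (Multiplicative.toAdd (Φ (c 0))) x with hm
    -- `Φ` maps `C` to the free abelian group on `X`, through which `ψ` factors. A coordinate of `Φ
    -- (c 0)` divisible by every power of `2` is zero, since `2 ^ |m| > |m|`.
    have hdvd : ∀ i, (2 : ℤ) ^ i ∣ m := by
      intro i
      refine ⟨(Multiplicative.toAdd (Φ (c i))) x, ?_⟩
      rw [hm, hpow i, map_pow, toAdd_pow, Finsupp.smul_apply, nsmul_eq_mul]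
      simp
    have h1 := hdvd m.natAbs
    change m = 0
    by_contra h0
    have h2 := Int.le_of_dvd (Int.natAbs_pos.2 h0 |> fun h => by exact_mod_cast h)
      ((Int.dvd_natAbs).2 h1)
    have h3 : m.natAbs < 2 ^ m.natAbs := Nat.lt_two_pow_self
    have h4 : (2 : ℤ) ^ m.natAbs = ((2 ^ m.natAbs : ℕ) : ℤ) := by push_cast; rfl
    rw [h4] at h2
    omega
  rw [← hΛ, MonoidHom.comp_apply, hΦ, map_one]

/-! ### The witness `b i * b (i + 1) ^ (-2)`. -/

section Witness

variable {B : Type u} [Group B] {b : ℕ → B}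

/-- The basis obtained by replacing the first `n` elements `b i` by `b i * b (i + 1) ^ (-2)`. -/
theorem IsFreeBasis.twist (hb : IsFreeBasis W b) (n : ℕ) :
    IsFreeBasis W (fun i => if i < n then b i * b (i + 1) ^ (-2 : ℤ) else b i) := by
  induction n with
  | zero => simpa using hb
  | succ n ih =>
    refine IsFreeBasis.of_closure hb.1 ?_ fun H _ hH f => ?_
    · rw [eq_top_iff, ← ih.closure_range, Subgroup.closure_le]
      rintro _ ⟨i, rfl⟩
      set S := Subgroup.closure
        (Set.range fun i => if i < n + 1 then b i * b (i + 1) ^ (-2 : ℤ) else b i)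
      have hmem : ∀ i, (if i < n + 1 then b i * b (i + 1) ^ (-2 : ℤ) else b i) ∈ S :=
        fun i => Subgroup.subset_closure ⟨i, rfl⟩
      rcases lt_trichotomy i n with h | rfl | h
      · have := hmem i
        rw [if_pos (by omega)] at this
        simpa [h] using this
      · have h1 := hmem i
        have h2 := hmem (i + 1)
        rw [if_pos (by omega)] at h1
        rw [if_neg (by omega)] at h2
        have := S.mul_mem h1 (S.zpow_mem h2 2)
        simpa [mul_assoc, ← zpow_add] using this
      · have := hmem i
        rw [if_neg (by omega)] at this
        have h' : ¬ i < n := by omega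
        simpa [h'] using this
    -- The value at `n` is forced: `b n` is the new `n`-th element times `b (n + 1) ^ 2`, and `b (n
    -- + 1)` is still in the basis.
    · let φ := ih.lift hH fun i => if i = n then f n * f (n + 1) ^ (2 : ℤ) else f i
      have hφ : ∀ i, φ (if i < n then b i * b (i + 1) ^ (-2 : ℤ) else b i) =
          if i = n then f n * f (n + 1) ^ (2 : ℤ) else f i := fun i => ih.lift_apply hH _ i
      refine ⟨φ, fun i => ?_⟩
      rcases lt_trichotomy i n with h | rfl | h
      · have := hφ i
        rw [if_pos h, if_neg h.ne] at this
        rw [if_pos (by omega), this]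
      · have h1 := hφ i
        have h2 := hφ (i + 1)
        rw [if_neg (by omega), if_pos rfl] at h1
        rw [if_neg (by omega), if_neg (by omega)] at h2
        rw [if_pos (by omega), map_mul, map_zpow, h1, h2, mul_assoc, ← zpow_add]
        simp
      · have := hφ i
        rw [if_neg (by omega), if_neg (by omega)] at this
        rw [if_neg (by omega), this]

/-- The value of a word depends on finitely many letters only. -/
theorem exists_letter_bound (r : FreeGroup ℕ) : ∃ n : ℕ, ∀ (G : Type u) [Group G] (v v' : ℕ → G),
    (∀ i < n, v i = v' i) → FreeGroup.lift v r = FreeGroup.lift v' r := by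
  induction r using FreeGroup.induction_on with
  | C1 => exact ⟨0, fun G _ v v' _ => by simp⟩
  | of i => exact ⟨i + 1, fun G _ v v' h => by simpa using h i (Nat.lt_succ_self i)⟩
  | inv_of i ih =>
    obtain ⟨n, hn⟩ := ih
    exact ⟨n, fun G _ v v' h => by rw [map_inv, map_inv, hn G v v' h]⟩
  | mul x y ihx ihy =>
    obtain ⟨n, hn⟩ := ihx
    obtain ⟨m, hm⟩ := ihy
    refine ⟨max n m, fun G _ v v' h => ?_⟩
    rw [map_mul, map_mul, hn G v v' fun i hi => h i (lt_of_lt_of_le hi (le_max_left _ _)),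
      hm G v v' fun i hi => h i (lt_of_lt_of_le hi (le_max_right _ _))]

/-- A sequence, all of whose initial segments are parts of free bases, is a free basis of the
subgroup that it generates. -/
theorem isFreeBasis_closure_of_initial {a : ℕ → B} (hB : InVariety W B)
    (h : ∀ (n : ℕ) (H : Type u) [Group H], InVariety W H → ∀ f : ℕ → H,
      ∃ φ : B →* H, ∀ i < n, φ (a i) = f i) :
    IsFreeBasis W
      (fun i => (⟨a i, Subgroup.subset_closure ⟨i, rfl⟩⟩ : Subgroup.closure (Set.range a))) := by
  have hgen : Subgroup.closure (Set.range fun i =>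
      (⟨a i, Subgroup.subset_closure ⟨i, rfl⟩⟩ : Subgroup.closure (Set.range a))) = ⊤ := by
    rw [← Subgroup.closure_closure_coe_preimage (k := Set.range a)]
    congr 1
    ext x
    constructor
    · rintro ⟨i, rfl⟩
      exact ⟨i, rfl⟩
    · rintro ⟨i, hi⟩
      exact ⟨i, Subtype.ext hi⟩
  refine IsFreeBasis.of_closure (hB.subgroup _) hgen fun H _ hH f => ?_
  set a' := fun i => (⟨a i, Subgroup.subset_closure ⟨i, rfl⟩⟩ : Subgroup.closure (Set.range a))
  have hsurj : Function.Surjective (FreeGroup.lift a') := by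
    rw [← MonoidHom.range_eq_top, FreeGroup.range_lift_eq_closure, hgen]
  -- A relation among the `a i` involves finitely many letters, on which some homomorphism from `B`
  -- already realizes `f`.
  have hker : (FreeGroup.lift a').ker ≤ (FreeGroup.lift f).ker := by
    intro r hr
    obtain ⟨n, hn⟩ := exists_letter_bound.{u} r
    obtain ⟨φ, hφ⟩ := h n H hH f
    have h1 := map_freeGroup_lift (φ.comp (Subgroup.subtype _)) a' r
    rw [MonoidHom.mem_ker.1 hr, map_one] at h1
    rw [MonoidHom.mem_ker, h1]
    exact hn H _ _ fun i hi => (hφ i hi).symm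
  refine ⟨(FreeGroup.lift a').liftOfSurjective hsurj ⟨FreeGroup.lift f, hker⟩, fun i => ?_⟩
  have := MonoidHom.liftOfRightInverse_comp_apply (FreeGroup.lift a') _
    (Function.rightInverse_surjInv hsurj) ⟨FreeGroup.lift f, hker⟩ (FreeGroup.of i)
  simpa using this

end Witness

end Variety

section Variety

variable {W : Set (FreeGroup ℕ)}

section Witness

variable {B : Type u} [Group B] {b : ℕ → B}

/-- The relations `b i = b (i + 1) ^ 2` make `b 0` infinitely `2`-divisible, which obstructs
being a free factor. -/
theorem IsFreeBasis.not_isFreeFactor_twist (hb : IsFreeBasis W b)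
    (hW : IsTorsionFreeVariety.{u} W) {C D : Type u} [Group C] [Group D] {β : B →* D} {γ : C →* D}
    (hβγ : IsFreeProduct W β γ) :
    ¬ IsFreeFactor W ((Subgroup.closure
      (Set.range fun i => b i * b (i + 1) ^ (-2 : ℤ))).map β) := by
  rintro ⟨-, -, C', hC', hfp⟩
  set A := Subgroup.closure (Set.range fun i => b i * b (i + 1) ^ (-2 : ℤ)) with hA
  let Q := Multiplicative (ULift.{u} ℚ)
  have hQ : InVariety W Q := hW.inVariety_of_comm Q
  -- In `ℚ`, written multiplicatively, these values satisfy `q i = q (i + 1) ^ 2`, so the induced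
  -- `ψ` kills `A` but not `b 0`.
  let q : ℕ → Q := fun i => Multiplicative.ofAdd (ULift.up (1 / 2 ^ i))
  have hq : ∀ i, q i = q (i + 1) ^ 2 := by
    intro i
    apply Multiplicative.toAdd.injective
    apply ULift.down_injective
    change (1 / 2 ^ i : ℚ) = 2 • (1 / 2 ^ (i + 1) : ℚ)
    rw [pow_succ]
    simp
  obtain ⟨ψ, ⟨hψβ, -⟩, -⟩ := hβγ.2 Q hQ (hb.lift hQ q) 1
  have hψb : ∀ i, ψ (β (b i)) = q i := fun i =>
    (DFunLike.congr_fun hψβ (b i)).trans (hb.lift_apply hQ q i)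
  have hψA : ∀ x : A.map β, ψ x = 1 := by
    have : A.map β ≤ ψ.ker := by
      rw [Subgroup.map_le_iff_le_comap, hA, Subgroup.closure_le]
      rintro _ ⟨i, rfl⟩
      change ψ (β (b i * b (i + 1) ^ (-2 : ℤ))) = 1
      rw [map_mul, map_mul, map_zpow, map_zpow, hψb, hψb, hq i]
      rw [zpow_neg, zpow_ofNat]
      exact mul_inv_cancel (q (i + 1) ^ 2)
    exact fun x => this x.2
  -- `π` projects onto the complement and kills `A`, so `ψ` factors through it, while the `π (β (b
  -- i))` are successive square roots in the free object `C'`.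
  obtain ⟨π, ⟨hπA, hπC⟩, -⟩ := hfp.2 C' (hfp.1.subgroup C') 1 (MonoidHom.id C')
  have hfac : (ψ.comp C'.subtype).comp π = ψ := by
    refine (hfp.2 Q hQ 1 (ψ.comp C'.subtype)).unique ⟨?_, ?_⟩ ⟨?_, rfl⟩
    · refine MonoidHom.ext fun x => ?_
      change ψ (C'.subtype (π (Subgroup.subtype _ x))) = 1
      rw [show π (Subgroup.subtype _ x) = 1 from DFunLike.congr_fun hπA x, map_one, map_one]
    · rw [MonoidHom.comp_assoc, hπC, MonoidHom.comp_id]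
    · exact MonoidHom.ext hψA
  have hc : ∀ i, π (β (b i)) = π (β (b (i + 1))) ^ 2 := by
    intro i
    have hmem : β (b i * b (i + 1) ^ (-2 : ℤ)) ∈ A.map β :=
      ⟨_, Subgroup.subset_closure ⟨i, rfl⟩, rfl⟩
    have h1 : π (β (b i * b (i + 1) ^ (-2 : ℤ))) = 1 := DFunLike.congr_fun hπA ⟨_, hmem⟩
    rw [map_mul, map_mul, map_zpow, map_zpow, zpow_neg, mul_inv_eq_one] at h1
    exact_mod_cast h1
  have h := hC'.map_eq_one_of_sqrt hW hc (ψ.comp C'.subtype)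
  have h2 : ψ (β (b 0)) = 1 := (DFunLike.congr_fun hfac (β (b 0))).symm.trans h
  rw [hψb] at h2
  have h3 := congrArg (fun x : Q => (Multiplicative.toAdd x).down) h2
  change (1 / 2 ^ 0 : ℚ) = 0 at h3
  norm_num at h3

/-- Since `(a i)⁻¹ * b i = b (i + 1) * b (i + 1)` has only one square root, the basis elements are
defined one after the other, starting from `b 0`. -/
theorem IsFreeBasis.dclQF_twist (hb : IsFreeBasis W b)
    (hroot : ∀ (i : ℕ) (y : B), y * y = b i * b i → y = b i) :
    dclQF groupLang ((Subgroup.closure (Set.range fun i => b i * b (i + 1) ^ (-2 : ℤ)) : Set B) ∪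
      {b 0}) = Set.univ := by
  rw [Set.eq_univ_iff_forall]
  rintro x T ⟨hT, hcl⟩
  have hA : ∀ y ∈ Subgroup.closure (Set.range fun i => b i * b (i + 1) ^ (-2 : ℤ)), y ∈ T :=
    fun y hy => hT (Or.inl hy)
  have hbT : ∀ i, b i ∈ T := by
    intro i
    induction i with
    | zero => exact hT (Or.inr rfl)
    | succ i ih =>
      apply hcl
      apply isQFDefinable_of_sq _ (hroot (i + 1))
      have h1 : (b i * b (i + 1) ^ (-2 : ℤ))⁻¹ ∈ T :=
        hA _ (Subgroup.inv_mem _ (Subgroup.subset_closure ⟨i, rfl⟩))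
      have h2 := hcl _ (isQFDefinable_mul h1 ih)
      have h3 : (b i * b (i + 1) ^ (-2 : ℤ))⁻¹ * b i = b (i + 1) * b (i + 1) := by
        rw [mul_inv_rev, inv_mul_cancel_right, zpow_neg, inv_inv]
        exact zpow_two (b (i + 1))
      rwa [h3] at h2
  let S : Subgroup B :=
    { carrier := T
      mul_mem' := fun hx hy => hcl _ (isQFDefinable_mul hx hy)
      one_mem' := hA 1 (Subgroup.one_mem _)
      inv_mem' := fun hx => hcl _ (isQFDefinable_inv hx) }
  have hS : Subgroup.closure (Set.range b) ≤ S := by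
    rw [Subgroup.closure_le]
    rintro _ ⟨i, rfl⟩
    exact hbT i
  rw [hb.closure_range] at hS
  exact hS (Subgroup.mem_top x)

theorem IsFreeBasis.isRCPWitness_twist (hb : IsFreeBasis W b) (hW : IsTorsionFreeVariety.{u} W)
    (hroot : ∀ (i : ℕ) (y : B), y * y = b i * b i → y = b i) :
    IsRCPWitness W B (fun i => b i * (b (i + 1)) ^ (-2 : ℤ)) b where
  free_b := hb
  free_a := isFreeBasis_closure_of_initial hb.1 fun n H _ hH f =>
    ⟨(hb.twist n).lift hH f, fun i hi => by
      have := (hb.twist n).lift_apply hH f i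
      rwa [if_pos hi] at this⟩
  initial_factor := fun i => by
    have h := hb.twist (i + 1)
    have := h.isFreeFactor (h.injective hW.1) {j | j ≤ i}
    convert this using 2
    refine Set.image_congr fun j hj => ?_
    rw [if_pos (Nat.lt_succ_of_le hj)]
  not_factor := fun C D _ _ β γ _ h => hb.not_isFreeFactor_twist hW h
  dcl_eq := hb.dclQF_twist hroot

end Witness

/-! ### Fixed points of automorphisms of free objects -/

section Automorphisms

variable {B : Type u} [Group B]

theorem map_mem_closure {G H : Type*} [Group G] [Group H] (φ : G →* H) {S : Set G} {S' : Set H}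
    (h : ∀ s ∈ S, φ s ∈ Subgroup.closure S') {x : G} (hx : x ∈ Subgroup.closure S) :
    φ x ∈ Subgroup.closure S' := by
  have : Subgroup.closure S ≤ (Subgroup.closure S').comap φ := by
    rw [Subgroup.closure_le]
    exact h
  exact this hx

theorem exists_finset_mem_closure {ι : Type*} {c : ι → B} {x : B}
    (hx : x ∈ Subgroup.closure (Set.range c)) :
    ∃ F : Finset ι, x ∈ Subgroup.closure (c '' (F : Set ι)) := by
  classical
  have hmono : ∀ F F' : Finset ι, F ⊆ F' →
      Subgroup.closure (c '' (F : Set ι)) ≤ Subgroup.closure (c '' (F' : Set ι)) :=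
    fun F F' h => Subgroup.closure_mono (Set.image_mono (Finset.coe_subset.2 h))
  induction hx using Subgroup.closure_induction with
  | mem x hx =>
    obtain ⟨i, rfl⟩ := hx
    exact ⟨{i}, Subgroup.subset_closure ⟨i, by simp, rfl⟩⟩
  | one => exact ⟨∅, Subgroup.one_mem _⟩
  | mul x y _ _ ihx ihy =>
    obtain ⟨F, hF⟩ := ihx
    obtain ⟨F', hF'⟩ := ihy
    exact ⟨F ∪ F', Subgroup.mul_mem _ (hmono _ _ Finset.subset_union_left hF)
      (hmono _ _ Finset.subset_union_right hF')⟩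
  | inv x _ ih =>
    obtain ⟨F, hF⟩ := ih
    exact ⟨F, Subgroup.inv_mem _ hF⟩

theorem exists_nat_mem_closure {a : ℕ → B} {x : B} (hx : x ∈ Subgroup.closure (Set.range a)) :
    ∃ n, ∀ m ≥ n, x ∈ Subgroup.closure (a '' {j | j ≤ m}) := by
  obtain ⟨F, hF⟩ := exists_finset_mem_closure hx
  refine ⟨F.sup id, fun m hm => Subgroup.closure_mono (Set.image_mono fun j hj => ?_) hF⟩
  exact (Finset.le_sup (f := id) hj).trans hm

/-- The automorphism induced by a permutation of a free basis. -/
theorem IsFreeBasis.exists_mulEquiv {ι : Type*} {c : ι → B} (hc : IsFreeBasis W c)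
    (τ : Equiv.Perm ι) : ∃ σ : B ≃* B, ∀ i, σ (c i) = c (τ i) := by
  refine ⟨MonoidHom.toMulEquiv (hc.lift hc.1 fun i => c (τ i))
    (hc.lift hc.1 fun i => c (τ.symm i)) (hc.hom_ext hc.1 fun i => by simp)
    (hc.hom_ext hc.1 fun i => by simp), fun i => ?_⟩
  exact hc.lift_apply hc.1 _ i

/-- Over a part of a free basis with infinite complement, only the elements that it generates
are fixed by all automorphisms. -/
theorem IsFreeBasis.mem_closure_of_fixed {ι Z : Type*} [Infinite Z] {a : ι → B} {z : Z → B}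
    (hc : IsFreeBasis W (Sum.elim a z)) {x : B}
    (hx : ∀ σ : B ≃* B, (∀ i, σ (a i) = a i) → σ x = x) :
    x ∈ Subgroup.closure (Set.range a) := by
  classical
  have key : ∀ F : Finset Z, x ∈ Subgroup.closure (Set.range a ∪ z '' (F : Set Z)) →
      x ∈ Subgroup.closure (Set.range a) := by
    intro F
    induction F using Finset.induction_on with
    | empty => intro h; simpa using h
    | insert k F hk ih =>
      intro h
      apply ih
      -- Swapping `z k` with a fresh `z k'` fixes `x`, so `x` can be written without `z k`. The
      -- retraction killing `z k` therefore fixes `x`, and it deletes `z k` from the original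
      -- expression.
      obtain ⟨k', hk'⟩ := Infinite.exists_notMem_finset (insert k F)
      obtain ⟨σ, hσ⟩ := hc.exists_mulEquiv (Equiv.sumCongr (Equiv.refl ι) (Equiv.swap k k'))
      have hσa : ∀ i, σ (a i) = a i := fun i => hσ (Sum.inl i)
      have hσz : ∀ j, σ (z j) = z (Equiv.swap k k' j) := fun j => hσ (Sum.inr j)
      let r : B →* B := hc.lift hc.1 (Sum.elim a fun j => if j = k then 1 else z j)
      have hra : ∀ i, r (a i) = a i := fun i => hc.lift_apply hc.1 _ (Sum.inl i)
      have hrz : ∀ j, r (z j) = if j = k then 1 else z j := fun j => hc.lift_apply hc.1 _ (Sum.inr j)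
      have h1 : σ.toMonoidHom x ∈ Subgroup.closure (Set.range a ∪ z '' {k}ᶜ) := by
        refine map_mem_closure _ ?_ h
        rintro _ (⟨i, rfl⟩ | ⟨j, hj, rfl⟩)
        · exact Subgroup.subset_closure (Or.inl ⟨i, (hσa i).symm⟩)
        · refine Subgroup.subset_closure (Or.inr ⟨Equiv.swap k k' j, ?_, (hσz j).symm⟩)
          have hjk' : j ≠ k' := by rintro rfl; exact hk' hj
          intro hk0
          rw [Set.mem_singleton_iff, Equiv.swap_apply_eq_iff, Equiv.swap_apply_left] at hk0
          exact hjk' hk0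
      have h2 : x ∈ Subgroup.closure (Set.range a ∪ z '' {k}ᶜ) := by
        have := hx σ hσa
        change σ x ∈ _ at h1
        rwa [this] at h1
      have h3 : r x = x := by
        refine MonoidHom.eqOn_closure (f := r) (g := MonoidHom.id B) ?_ h2
        rintro _ (⟨i, rfl⟩ | ⟨j, hj, rfl⟩)
        · exact hra i
        · rw [hrz, if_neg (show ¬ j = k from hj)]; rfl
      rw [← h3]
      refine map_mem_closure r ?_ h
      rintro _ (⟨i, rfl⟩ | ⟨j, hj, rfl⟩)
      · rw [hra]
        exact Subgroup.subset_closure (Or.inl ⟨i, rfl⟩)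
      · rw [hrz]
        split_ifs with hjk
        · exact Subgroup.one_mem _
        · refine Subgroup.subset_closure (Or.inr ⟨j, ?_, rfl⟩)
          exact (Finset.mem_insert.1 hj).resolve_left hjk
  obtain ⟨F, hF⟩ := exists_finset_mem_closure (c := Sum.elim a z) (x := x)
    (hc.closure_range ▸ Subgroup.mem_top x)
  refine key (F.preimage Sum.inr Sum.inr_injective.injOn) (Subgroup.closure_mono ?_ hF)
  rintro _ ⟨i | j, hj, rfl⟩
  · exact Or.inl ⟨i, rfl⟩
  · exact Or.inr ⟨j, by simpa using hj, rfl⟩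

/-- A finite `c` would use only finitely many of the `b j`; a homomorphism that is nontrivial only
at an unused `b i` would vanish on `c`. -/
theorem IsFreeBasis.infinite_of_infinite (hW : IsTorsionFreeVariety.{u} W) {ι κ : Type*}
    [Infinite ι] {b : ι → B} {c : κ → B} (hb : IsFreeBasis W b) (hc : IsFreeBasis W c) :
    Infinite κ := by
  classical
  by_contra hfin
  rw [not_infinite_iff_finite] at hfin
  have := Fintype.ofFinite κ
  choose F hF using fun k => exists_finset_mem_closure (c := b) (x := c k)
    (hb.closure_range ▸ Subgroup.mem_top (c k))
  obtain ⟨i, hi⟩ := Infinite.exists_notMem_finset (Finset.univ.biUnion F)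
  obtain ⟨H, _, hH, hn⟩ := hW.1
  obtain ⟨h, hh⟩ := exists_ne (1 : H)
  let φ : B →* H := hb.lift hH fun j => if j = i then h else 1
  have hφ : ∀ j, φ (b j) = if j = i then h else 1 := hb.lift_apply hH _
  have h1 : φ = 1 := by
    refine hc.hom_ext hH fun k => ?_
    have hle : Subgroup.closure (b '' (F k : Set ι)) ≤ φ.ker := by
      rw [Subgroup.closure_le]
      rintro _ ⟨j, hj, rfl⟩
      have hji : j ≠ i := by
        rintro rfl
        exact hi (Finset.mem_biUnion.2 ⟨k, Finset.mem_univ k, hj⟩)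
      change φ (b j) = 1
      rw [hφ, if_neg hji]
    exact hle (hF k)
  have h2 := hφ i
  rw [if_pos rfl, h1] at h2
  exact hh h2.symm

end Automorphisms

/-! ### The element `b 0` lies outside `A`. -/

namespace IsRCPWitness

variable {B : Type u} [Group B] {a b : ℕ → B}

/-- The initial segments of `a` extend to free bases. -/
theorem exists_basis (h : IsRCPWitness W B a b) (i : ℕ) :
    ∃ (Z : Type u) (z : Z → B), IsFreeBasis W (Sum.elim (fun j : {j | j ≤ i} => a j) z) := by
  have hi := h.initial_factor i
  have hA := h.free_a.restrict {j | j ≤ i}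
  set s : Set ℕ := {j | j ≤ i}
  let a' := fun i => (⟨a i, Subgroup.subset_closure ⟨i, rfl⟩⟩ : Subgroup.closure (Set.range a))
  have hmap : (Subgroup.closure (a' '' s)).map (Subgroup.subtype _) =
      Subgroup.closure (a '' s) := by
    rw [MonoidHom.map_closure, Set.image_image]
    rfl
  have hinj := (Subgroup.closure (Set.range a)).subtype_injective
  let e : Subgroup.closure (a' '' s) ≃* Subgroup.closure (a '' s) :=
    ((Subgroup.closure (a' '' s)).equivMapOfInjective _ hinj).trans (MulEquiv.subgroupCongr hmap)
  exact hi.exists_basis (hA.map_equiv e)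

/-- The subgroup `A` is closed under quantifier-free definability: finitely many parameters lie in
the span of an initial segment of `a`, and only elements of that span are fixed by all automorphisms
over it. With `b 0 ∈ A` this would give `A = B`, a free factor of `B * 1`. -/
theorem b_zero_notMem (h : IsRCPWitness W B a b) (hW : IsTorsionFreeVariety.{u} W) :
    b 0 ∉ Subgroup.closure (Set.range a) := by
  intro hmem
  have hdcl : dclQF groupLang ((Subgroup.closure (Set.range a) : Set B) ∪ {b 0}) ⊆
      (Subgroup.closure (Set.range a) : Set B) := by
    refine dclQF_subset_of_automorphisms
      (Set.union_subset subset_rfl (Set.singleton_subset_iff.2 hmem)) ?_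
    intro F hF x hx
    choose! n hn using fun y (hy : y ∈ F) => exists_nat_mem_closure (hF hy)
    obtain ⟨Z, z, hz⟩ := h.exists_basis (F.sup n)
    have hZ : Infinite Z := by
      have := h.free_b.infinite_of_infinite hW hz
      by_contra hfin
      rw [not_infinite_iff_finite] at hfin
      have : Finite {j | j ≤ F.sup n} := (Set.finite_Iic _).to_subtype
      exact not_finite ({j | j ≤ F.sup n} ⊕ Z)
    by_contra! hσ
    apply hx
    have := hz.mem_closure_of_fixed (x := x) fun σ hσa => hσ σ fun y hy => by
      have hy' := hn y hy _ (Finset.le_sup hy)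
      refine MonoidHom.eqOn_closure (f := σ.toMonoidHom) (g := MonoidHom.id B) ?_ hy'
      rintro _ ⟨j, hj, rfl⟩
      exact hσa ⟨j, hj⟩
    refine Subgroup.closure_mono ?_ this
    rintro _ ⟨j, rfl⟩
    exact ⟨j, rfl⟩
  rw [h.dcl_eq, Set.univ_subset_iff] at hdcl
  have htop : Subgroup.closure (Set.range a) = ⊤ := SetLike.coe_injective hdcl
  have hPU : IsFreeBasis W (fun x : (∅ : Set PUnit.{u + 1}) => (x : PUnit.{u + 1})) := by
    refine ⟨fun r _ v => rfl, fun H _ hH f => ⟨1, fun i => i.2.elim, fun φ _ => ?_⟩⟩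
    ext x
    rw [show x = 1 from rfl, map_one, map_one]
  refine h.not_factor PUnit.{u + 1} B (MonoidHom.id B) 1 ⟨∅, hPU⟩ ?_ ?_
  · refine ⟨h.free_b.1, fun H _ hH f g => ⟨f, ⟨rfl, ?_⟩, fun φ hφ => hφ.1⟩⟩
    ext x
    rw [show x = 1 from rfl, map_one, map_one]
  · rw [Subgroup.map_id, htop, ← h.free_b.closure_range, ← Set.image_univ]
    exact h.free_b.isFreeFactor (h.free_b.injective hW.1) Set.univ

end IsRCPWitness

end Variety

/-! ### Strong embeddings between free objects. -/

section Variety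

variable {W : Set (FreeGroup ℕ)} {K : AbstractClass.{u} groupLang}

namespace IsAECCovering

open AbstractClass

variable (hcov : IsAECCovering W K)
include hcov

theorem mem_of_basis (hW : IsTorsionFreeVariety.{u} W) {G : Type u} [Group G] {ι : Type*}
    [Infinite ι] {c : ι → G} (hc : IsFreeBasis W c) : K.Mem G :=
  hcov.free_mem G (hc.isFreeInf (hc.injective hW.1))

/-- A subgroup generated by an infinite part of a free basis is a strong submodel. -/
theorem closure_mem_strong (hW : IsTorsionFreeVariety.{u} W) {G : Type u} [Group G] {ι : Type*}
    {c : ι → G} (hc : IsFreeBasis W c) {s : Set ι} (hs : s.Infinite) :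
    toSub (Subgroup.closure (c '' s)) ∈ K.strong (asStr groupLang G) := by
  have : Infinite s := hs.to_subtype
  have : Infinite ι := Infinite.of_injective _ (Subtype.val_injective (p := (· ∈ s)))
  exact hcov.strong_of_factor G _ (hcov.mem_of_basis hW hc)
    (hcov.mem_of_basis hW (hc.restrict s)) (hc.isFreeFactor (hc.injective hW.1) s)

/-- A homomorphism that maps a free basis to an infinite part of a free basis is a strong
embedding. -/
theorem strong_of_basis (hW : IsTorsionFreeVariety.{u} W) {G H : Type u} [Group G] [Group H]
    {ι κ : Type*} [Infinite ι] {c : ι → G} {y : κ → H} (hc : IsFreeBasis W c) {θ : G →* H}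
    (hθ : IsFreeBasis W (Sum.elim (fun i => θ (c i)) y)) :
    ∃ hinj : Function.Injective θ, K.Strong (homEmb θ hinj) := by
  have hinj : Function.Injective θ := by
    let ρ : H →* G := hθ.lift hc.1 (Sum.elim c fun _ => 1)
    have hρ : ρ.comp θ = MonoidHom.id G :=
      hc.hom_ext hc.1 fun i => hθ.lift_apply hc.1 _ (Sum.inl i)
    exact Function.LeftInverse.injective (g := ρ) fun x => DFunLike.congr_fun hρ x
  refine ⟨hinj, ?_⟩
  have h := hcov.closure_mem_strong hW hθ (s := Set.range Sum.inl)
    (Set.infinite_range_of_injective Sum.inl_injective)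
  have hrange : Subgroup.closure (Sum.elim (fun i => θ (c i)) y '' Set.range Sum.inl) =
      θ.range := by
    rw [← Set.range_comp, MonoidHom.range_eq_map, ← hc.closure_range, MonoidHom.map_closure,
      ← Set.range_comp]
    rfl
  rw [hrange, ← range_homEmb θ hinj] at h
  exact h

/-- If `(B, a, b)` is a witness, then `A * Y ≼ B * Y` for every `Y` free of infinite rank. -/
theorem strong_of_witness (hW : IsTorsionFreeVariety.{u} W) {B : Type u} [Group B] {a b : ℕ → B}
    (hB : IsRCPWitness W B a b) {G H : Type u} [Group G] [Group H] {Y : Type*} [Infinite Y]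
    {α : ℕ → G} {y' : Y → G} {y : Y → H} {β : B →* H} {θ : G →* H}
    (hG : IsFreeBasis W (Sum.elim α y')) (hH : IsFreeBasis W (Sum.elim (fun i => β (b i)) y))
    (hα : ∀ i, θ (α i) = β (a i)) (hy : ∀ k, θ (y' k) = y k) :
    ∃ hinj : Function.Injective θ, K.Strong (homEmb θ hinj) := by
  choose Z z hz using hB.exists_basis
  have hc := fun i => hB.free_b.replace (hz i) hH
  -- `G` is the union of the `G' i`, and `θ` maps the generators of `G' i` onto part of the basis
  -- `hc i` of `H`. This gives a left inverse of `θ` on each `G' i`, and makes its image a free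
  -- factor.
  let G' : ℕ → Subgroup G := fun i => Subgroup.closure (α '' {j | j ≤ i} ∪ Set.range y')
  have hmono : Monotone G' := fun i j hij => Subgroup.closure_mono
    (Set.union_subset_union_left _ (Set.image_mono fun k hk => le_trans hk hij))
  have hG' : ∀ g, ∃ i, g ∈ G' i := by
    intro g
    have hg : g ∈ Subgroup.closure (Set.range (Sum.elim α y')) :=
      hG.closure_range ▸ Subgroup.mem_top g
    induction hg using Subgroup.closure_induction with
    | mem g hg =>
      obtain ⟨i | k, rfl⟩ := hg
      · exact ⟨i, Subgroup.subset_closure (Or.inl ⟨i, show i ≤ i from le_rfl, rfl⟩)⟩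
      · exact ⟨0, Subgroup.subset_closure (Or.inr ⟨k, rfl⟩)⟩
    | one => exact ⟨0, Subgroup.one_mem _⟩
    | mul g h _ _ ihg ihh =>
      obtain ⟨i, hi⟩ := ihg
      obtain ⟨j, hj⟩ := ihh
      exact ⟨max i j, Subgroup.mul_mem _ (hmono (le_max_left i j) hi)
        (hmono (le_max_right i j) hj)⟩
    | inv g _ ih =>
      obtain ⟨i, hi⟩ := ih
      exact ⟨i, Subgroup.inv_mem _ hi⟩
  have hinj : Function.Injective θ := by
    rw [injective_iff_map_eq_one]
    intro g hg
    obtain ⟨i, hi⟩ := hG' g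
    let ρ : H →* G := (hc i).lift hG.1
      (Sum.elim (Sum.elim (fun j : {j | j ≤ i} => α j) fun _ => 1) y')
    have hρ : Set.EqOn (ρ.comp θ) (MonoidHom.id G) (α '' {j | j ≤ i} ∪ Set.range y') := by
      rintro _ (⟨j, hj, rfl⟩ | ⟨k, rfl⟩)
      · change ρ (θ (α j)) = α j
        rw [hα]
        exact (hc i).lift_apply hG.1 _ (Sum.inl (Sum.inl ⟨j, hj⟩))
      · change ρ (θ (y' k)) = y' k
        rw [hy]
        exact (hc i).lift_apply hG.1 _ (Sum.inr k)
    have := MonoidHom.eqOn_closure hρ hi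
    change ρ (θ g) = g at this
    rw [← this, hg, map_one]
  refine ⟨hinj, ?_⟩
  have hstr : ∀ i, toSub ((G' i).map θ) ∈ K.strong (asStr groupLang H) := by
    intro i
    -- Infinitude of `Y` matters here: the covering is only known to contain the free objects of
    -- infinite rank.
    have hs : (Set.range (fun j : {j | j ≤ i} => (Sum.inl (Sum.inl j) : ({j | j ≤ i} ⊕ Z i) ⊕ Y)) ∪
        Set.range Sum.inr).Infinite :=
      (Set.infinite_range_of_injective Sum.inr_injective).mono Set.subset_union_right
    have := hcov.closure_mem_strong hW (hc i) hs
    convert this using 3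
    rw [MonoidHom.map_closure, Set.image_union, Set.image_union, ← Set.range_comp, ← Set.range_comp,
      ← Set.range_comp, Set.image_image]
    congr 1
    ext x
    constructor
    · rintro (⟨j, hj, rfl⟩ | ⟨k, rfl⟩)
      · exact Or.inl ⟨⟨j, hj⟩, (hα j).symm⟩
      · exact Or.inr ⟨k, (hy k).symm⟩
    · rintro (⟨⟨j, hj⟩, rfl⟩ | ⟨k, rfl⟩)
      · exact Or.inl ⟨j, hj, hα j⟩
      · exact Or.inr ⟨k, hy k⟩
  have hsub : ∀ S T : Subgroup H, S ≤ T → toSub S ≤ toSub T := fun S T h x hx => h hx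
  have hchain := hcov.isAEC.iSup_chain (J := ULift.{u} ℕ)
    (fun i => toSub ((G' i.down).map θ)) fun i j hij =>
      hcov.isAEC.coherence (asStr groupLang H) _ _ (hstr _) (hstr _)
        (hsub _ _ (Subgroup.map_mono (hmono hij)))
  have hsup : (⨆ i : ULift.{u} ℕ, toSub ((G' i.down).map θ)) = (homEmb θ hinj).toHom.range := by
    rw [range_homEmb]
    apply le_antisymm
    · refine iSup_le fun i => hsub _ _ ?_
      rintro _ ⟨g, -, rfl⟩
      exact ⟨g, rfl⟩
    · rintro _ ⟨g, rfl⟩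
      obtain ⟨i, hi⟩ := hG' g
      exact le_iSup (fun i : ULift.{u} ℕ => toSub ((G' i.down).map θ)) ⟨i⟩ ⟨g, hi, rfl⟩
  unfold Strong
  rw [← hsup, ← hcov.isAEC.strongLE_top]
  exact hchain.2 ⊤ fun i => hcov.isAEC.strongLE_top.2 (hstr _)

end IsAECCovering

end Variety

/-! ### Branch extensions and their amalgams. -/

section Variety

variable {W : Set (FreeGroup ℕ)}

/-- If `M` is free on `c`, then `m : M → P` is the extension of `M` obtained by extending the
subgroup generated by the `c (p i)` as `A` is extended by `B`; here `β : B → P` is the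
inclusion. -/
structure IsBranch (W : Set (FreeGroup ℕ)) {B M P : Type u} [Group B] [Group M] [Group P]
    (a b : ℕ → B) {X : Type*} (c : X → M) (p : ℕ → X) (m : M →* P) (β : B →* P) : Prop where
  basis : IsFreeBasis W
    (Sum.elim (fun i => β (b i)) fun x : {x // x ∉ Set.range p} => m (c x))
  map_branch : ∀ i, m (c (p i)) = β (a i)

theorem IsFreeBasis.exists_isBranch {B M : Type u} [Group B] [Group M] {a b : ℕ → B} {X : Type u}
    {c : X → M} (hc : IsFreeBasis W c) (hb : IsFreeBasis W b) {p : ℕ → X}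
    (hp : Function.Injective p) :
    ∃ (P : Type u) (_ : Group P) (m : M →* P) (β : B →* P), IsBranch W a b c p m β := by
  classical
  let T := ULift.{u} ℕ ⊕ {x // x ∉ Set.range p}
  have hv : InVariety W (VFree W T) := inVariety_vfree T
  let β : B →* VFree W T := hb.lift hv fun i => vof W (Sum.inl ⟨i⟩)
  -- The default `1` is never reached, as each letter is either on the branch or in the complement.
  let m : M →* VFree W T := hc.lift hv (Function.extend p (fun i => β (a i))
    (Function.extend Subtype.val (fun x => vof W (Sum.inr x)) 1))
  have hm : ∀ x : {x // x ∉ Set.range p}, m (c x) = vof W (Sum.inr x) := fun x => by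
    have : ¬ ∃ i, p i = x.1 := x.2
    rw [hc.lift_apply hv, Function.extend_apply' _ _ _ this, Subtype.val_injective.extend_apply]
  refine ⟨VFree W T, inferInstance, m, β, ?_, fun i => ?_⟩
  · refine (isFreeBasis_vof T).reindex_bijective (Sum.map ULift.up id)
      (Function.Bijective.sumMap Equiv.ulift.symm.bijective Function.bijective_id) ?_
    rintro (i | x)
    · exact (hb.lift_apply hv (fun i => vof W (Sum.inl ⟨i⟩ : T)) i).symm
    · exact (hm x).symm
  · rw [hc.lift_apply hv, hp.extend_apply]

namespace IsAECCovering

open AbstractClass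

variable {K : AbstractClass.{u} groupLang} (hcov : IsAECCovering W K)
include hcov

/-- With `Y` the letters off the branch, `M → P` has the form `A * Y → B * Y`. -/
theorem strong_of_isBranch (hW : IsTorsionFreeVariety.{u} W) {B M P : Type u} [Group B] [Group M]
    [Group P] {a b : ℕ → B} (hB : IsRCPWitness W B a b) {X : Type*} {c : X → M}
    (hc : IsFreeBasis W c) {p : ℕ → X} (hp : Function.Injective p)
    (hinf : (Set.range p)ᶜ.Infinite) {m : M →* P} {β : B →* P} (h : IsBranch W a b c p m β) :
    ∃ hinj : Function.Injective m, K.Strong (homEmb m hinj) := by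
  have : Infinite {x // x ∉ Set.range p} := hinf.to_subtype
  have hbas : IsFreeBasis W (Sum.elim (fun i => c (p i)) fun x : {x // x ∉ Set.range p} => c x) := by
    refine hc.reindex_bijective (Sum.elim p Subtype.val) ⟨?_, fun x => ?_⟩ (by rintro (i | x) <;> rfl)
    · exact hp.sumElim Subtype.val_injective fun i x hix => x.2 ⟨i, hix⟩
    · by_cases hx : x ∈ Set.range p
      · obtain ⟨i, rfl⟩ := hx
        exact ⟨Sum.inl i, rfl⟩
      · exact ⟨Sum.inr ⟨x, hx⟩, rfl⟩
  exact hcov.strong_of_witness hW hB hbas h.basis h.map_branch fun _ => rfl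

/-- A branch over `p` embeds strongly into the free amalgam, over an initial segment of `a`, of the
branches over `p` and `q`. -/
theorem strong_of_two_branches (hW : IsTorsionFreeVariety.{u} W) {B M P Q : Type u} [Group B]
    [Group M] [Group P] [Group Q] {a b : ℕ → B} (hB : IsRCPWitness W B a b) {X : Type*} {c : X → M}
    {p q : ℕ → X} (hq : Function.Injective q) {k : ℕ}
    (heq : ∀ j ≤ k, p j = q j) (hne : ∀ i j, p i = q j → i = j ∧ i ≤ k)
    {s : Set X} (hs : ∀ x, x ∈ s ↔ x ∉ Set.range p ∧ x ∉ Set.range q) (hinf : s.Infinite)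
    {Z : Type*} {z : Z → B} (hz : IsFreeBasis W (Sum.elim (fun j : {j | j ≤ k} => a j) z))
    {m : M →* P} {β : B →* P} (h : IsBranch W a b c p m β) {β₁ β₂ : B →* Q} {r : s → Q}
    (hQ : IsFreeBasis W (Sum.elim (fun i => β₂ (b i)) (Sum.elim (fun i => β₁ (z i)) r)))
    {i : P →* Q} (hi : i.comp β = β₁) (hiq : ∀ j, i (m (c (q j))) = β₂ (a j))
    (hir : ∀ x : s, i (m (c x)) = r x) :
    ∃ hinj : Function.Injective i, K.Strong (homEmb i hinj) := by
  have : Infinite s := hinf.to_subtype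
  have hqp : ∀ j, ¬ j ≤ k → q j ∉ Set.range p := by
    rintro j hj ⟨i, hij⟩
    obtain ⟨rfl, hi⟩ := hne i j hij
    exact hj hi
  -- A basis of `P` consists of `a 0, …, a k`, `z` and the nodes off `p`. The first group together
  -- with the nodes of `q` off `p` is the whole branch `q`, so `P` is a copy of `A` times a free
  -- object on `Z ⊕ s`, and `P → Q` extends that copy to `B`.
  let τ : ℕ ⊕ (Z ⊕ s) → ({j | j ≤ k} ⊕ Z) ⊕ {x // x ∉ Set.range p} :=
    Sum.elim (fun j => if hj : j ≤ k then Sum.inl (Sum.inl ⟨j, hj⟩) else Sum.inr ⟨q j, hqp j hj⟩)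
      (Sum.elim (fun t => Sum.inl (Sum.inr t)) fun x => Sum.inr ⟨x, ((hs x).1 x.2).1⟩)
  have hτ₁ : ∀ j (hj : j ≤ k), τ (Sum.inl j) = Sum.inl (Sum.inl ⟨j, hj⟩) := fun j hj => dif_pos hj
  have hτ₂ : ∀ j (hj : ¬ j ≤ k), τ (Sum.inl j) = Sum.inr ⟨q j, hqp j hj⟩ := fun j hj => dif_neg hj
  have hsq : ∀ (x : s) j, x.1 ≠ q j := fun x j hx => ((hs x).1 x.2).2 ⟨j, hx.symm⟩
  have hτ : Function.Bijective τ := by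
    constructor
    · refine Function.Injective.sumElim ?_ ?_ ?_
      · intro j j' hjj
        by_cases hj : j ≤ k <;> by_cases hj' : j' ≤ k <;> simp only [hj, hj', dif_pos, dif_neg,
          not_false_eq_true, Sum.inl.injEq, Sum.inr.injEq, Subtype.mk.injEq, reduceCtorEq] at hjj
        · exact hjj
        · exact hq hjj
      · refine Function.Injective.sumElim (fun t t' h => by simpa using h)
          (fun x x' h => by simpa [Subtype.ext_iff] using h) (fun _ _ => by simp)
      · rintro j (t | x)
        · by_cases hj : j ≤ k <;> simp [hj]
        · by_cases hj : j ≤ k <;> simp [hj, (hsq x j).symm]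
    · rintro ((⟨j, hj⟩ | t) | ⟨x, hx⟩)
      · exact ⟨Sum.inl j, hτ₁ j hj⟩
      · exact ⟨Sum.inr (Sum.inl t), rfl⟩
      · by_cases hxq : x ∈ Set.range q
        · obtain ⟨j, rfl⟩ := hxq
          have hj : ¬ j ≤ k := fun hj => hx ⟨j, heq j hj⟩
          exact ⟨Sum.inl j, hτ₂ j hj⟩
        · exact ⟨Sum.inr (Sum.inr ⟨x, (hs x).2 ⟨hx, hxq⟩⟩), rfl⟩
  have hP : IsFreeBasis W (Sum.elim (fun j => m (c (q j)))
      (Sum.elim (fun t => β (z t)) fun x : s => m (c x))) := by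
    refine (hB.free_b.replace hz h.basis).reindex_bijective τ hτ ?_
    rintro (j | t | x)
    · by_cases hj : j ≤ k
      · rw [hτ₁ j hj]
        change β (a j) = m (c (q j))
        rw [← heq j hj, h.map_branch]
      · rw [hτ₂ j hj]
        rfl
    · rfl
    · rfl
  refine hcov.strong_of_witness hW hB hP hQ hiq ?_
  rintro (t | x)
  · exact DFunLike.congr_fun hi (z t)
  · exact hir x

/-- Two branches that have an initial segment in common are amalgamated in such a way that the
new elements of the first one stay outside of the copy of `B` in the second one. -/
theorem exists_amalgam_of_branches (hW : IsTorsionFreeVariety.{u} W) {B M P₁ P₂ : Type u}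
    [Group B] [Group M] [Group P₁] [Group P₂] {a b : ℕ → B} (hB : IsRCPWitness W B a b)
    {X : Type u} {c : X → M} (hc : IsFreeBasis W c) {p q : ℕ → X} (hp : Function.Injective p)
    (hq : Function.Injective q) {k : ℕ} (heq : ∀ j ≤ k, p j = q j)
    (hne : ∀ i j, p i = q j → i = j ∧ i ≤ k) (hinf : (Set.range p ∪ Set.range q)ᶜ.Infinite)
    {m₁ : M →* P₁} {β₁ : B →* P₁} (h₁ : IsBranch W a b c p m₁ β₁)
    {m₂ : M →* P₂} {β₂ : B →* P₂} (h₂ : IsBranch W a b c q m₂ β₂) :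
    ∃ (Q : Type u) (_ : Group Q) (i₁ : P₁ →* Q) (i₂ : P₂ →* Q)
      (hi₁ : Function.Injective i₁) (hi₂ : Function.Injective i₂)
      (hβ : Function.Injective (i₂.comp β₂)),
      K.Strong (homEmb i₁ hi₁) ∧ K.Strong (homEmb i₂ hi₂) ∧ K.Strong (homEmb (i₂.comp β₂) hβ) ∧
      (∀ x, i₁ (m₁ x) = i₂ (m₂ x)) ∧ i₁ (β₁ (b 0)) ∉ (i₂.comp β₂).range := by
  classical
  obtain ⟨Z, z, hz⟩ := hB.exists_basis k
  set s : Set X := (Set.range p ∪ Set.range q)ᶜ with hs_def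
  have hs : ∀ x, x ∈ s ↔ x ∉ Set.range p ∧ x ∉ Set.range q := fun x => by
    simp only [hs_def, Set.mem_compl_iff, Set.mem_union, not_or]
  let U := ULift.{u} {j | j ≤ k}
  -- The letters are the common segment `a 0, …, a k`, the `z` of the second copy of `B`, the `z` of
  -- the first copy, and the nodes on neither branch.
  let T := (U ⊕ Z) ⊕ (Z ⊕ s)
  have hv : InVariety W (VFree W T) := inVariety_vfree T
  let γ₂ : B →* VFree W T := hz.lift hv
    (Sum.elim (fun j => vof W (Sum.inl (Sum.inl ⟨j⟩))) fun t => vof W (Sum.inl (Sum.inr t)))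
  let γ₁ : B →* VFree W T := hz.lift hv
    (Sum.elim (fun j => vof W (Sum.inl (Sum.inl ⟨j⟩))) fun t => vof W (Sum.inr (Sum.inl t)))
  let r : s → VFree W T := fun x => vof W (Sum.inr (Sum.inr x))
  have ha₂ : ∀ j (hj : j ≤ k), γ₂ (a j) = vof W (Sum.inl (Sum.inl ⟨j, hj⟩)) := fun j hj =>
    hz.lift_apply hv _ (Sum.inl ⟨j, hj⟩)
  have ha₁ : ∀ j (hj : j ≤ k), γ₁ (a j) = vof W (Sum.inl (Sum.inl ⟨j, hj⟩)) := fun j hj =>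
    hz.lift_apply hv _ (Sum.inl ⟨j, hj⟩)
  have hz₂ : ∀ t, γ₂ (z t) = vof W (Sum.inl (Sum.inr t)) := fun t =>
    hz.lift_apply hv _ (Sum.inr t)
  have hz₁ : ∀ t, γ₁ (z t) = vof W (Sum.inr (Sum.inl t)) := fun t =>
    hz.lift_apply hv _ (Sum.inr t)
  have hQ₂ : IsFreeBasis W (Sum.elim (fun i => γ₂ (b i)) (Sum.elim (fun t => γ₁ (z t)) r)) := by
    refine hz.replace hB.free_b ((isFreeBasis_vof T).reindex_bijective
      (Sum.map (Sum.map ULift.up id) id) ?_ ?_)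
    · exact (Equiv.ulift.symm.bijective.sumMap Function.bijective_id).sumMap
        Function.bijective_id
    · rintro ((j | t) | (t | x))
      · exact (ha₂ j j.2).symm
      · exact (hz₂ t).symm
      · exact (hz₁ t).symm
      · rfl
  have hQ₁ : IsFreeBasis W (Sum.elim (fun i => γ₁ (b i)) (Sum.elim (fun t => γ₂ (z t)) r)) := by
    refine hz.replace hB.free_b ((isFreeBasis_vof T).reindex_bijective
      (Sum.elim (Sum.elim (fun j => Sum.inl (Sum.inl ⟨j⟩)) fun t => Sum.inr (Sum.inl t))
        (Sum.elim (fun t => Sum.inl (Sum.inr t)) fun x => Sum.inr (Sum.inr x))) ?_ ?_)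
    · refine Function.bijective_iff_has_inverse.2
        ⟨Sum.elim (Sum.elim (fun j => Sum.inl (Sum.inl j.down)) fun t => Sum.inr (Sum.inl t))
          (Sum.elim (fun t => Sum.inl (Sum.inr t)) fun x => Sum.inr (Sum.inr x)), ?_, ?_⟩ <;>
      rintro ((j | t) | (t | x)) <;> rfl
    · rintro ((j | t) | (t | x))
      · exact (ha₁ j j.2).symm
      · exact (hz₁ t).symm
      · exact (hz₂ t).symm
      · rfl
  -- `f` is the intended common map on the nodes of the tree. The two clauses agree on shared nodes
  -- because `γ₁` and `γ₂` agree on `a 0, …, a k`.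
  let f : X → VFree W T := Function.extend p (fun i => γ₁ (a i))
    (Function.extend q (fun i => γ₂ (a i)) (Function.extend Subtype.val r 1))
  have hfp : ∀ i, f (p i) = γ₁ (a i) := fun i => hp.extend_apply _ _ i
  have hfq : ∀ j, f (q j) = γ₂ (a j) := fun j => by
    by_cases hj : ∃ i, p i = q j
    · obtain ⟨i, hij⟩ := hj
      obtain ⟨rfl, hik⟩ := hne i j hij
      rw [← hij, hfp, ha₁ i hik, ha₂ i hik]
    · exact (Function.extend_apply' _ _ _ hj).trans (hq.extend_apply _ _ j)
  have hfr : ∀ x : s, f x = r x := fun x =>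
    (Function.extend_apply' _ _ _ ((hs x).1 x.2).1).trans
      ((Function.extend_apply' _ _ _ ((hs x).1 x.2).2).trans
        (Subtype.val_injective.extend_apply _ _ x))
  let i₁ : P₁ →* VFree W T := h₁.basis.lift hv (Sum.elim (fun i => γ₁ (b i)) fun x => f x)
  let i₂ : P₂ →* VFree W T := h₂.basis.lift hv (Sum.elim (fun i => γ₂ (b i)) fun x => f x)
  have hi₁β : i₁.comp β₁ = γ₁ :=
    hB.free_b.hom_ext hv fun i => h₁.basis.lift_apply hv _ (Sum.inl i)
  have hi₂β : i₂.comp β₂ = γ₂ :=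
    hB.free_b.hom_ext hv fun i => h₂.basis.lift_apply hv _ (Sum.inl i)
  have hi₁m : ∀ x, i₁ (m₁ (c x)) = f x := fun x => by
    by_cases hx : x ∈ Set.range p
    · obtain ⟨i, rfl⟩ := hx
      rw [h₁.map_branch, hfp]
      exact DFunLike.congr_fun hi₁β (a i)
    · exact h₁.basis.lift_apply hv _ (Sum.inr ⟨x, hx⟩)
  have hi₂m : ∀ x, i₂ (m₂ (c x)) = f x := fun x => by
    by_cases hx : x ∈ Set.range q
    · obtain ⟨i, rfl⟩ := hx
      rw [h₂.map_branch, hfq]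
      exact DFunLike.congr_fun hi₂β (a i)
    · exact h₂.basis.lift_apply hv _ (Sum.inr ⟨x, hx⟩)
  obtain ⟨hinj₁, hst₁⟩ := hcov.strong_of_two_branches hW hB hq heq hne hs hinf hz h₁ hQ₂ hi₁β
    (fun j => (hi₁m _).trans (hfq j)) fun x => (hi₁m _).trans (hfr x)
  obtain ⟨hinj₂, hst₂⟩ := hcov.strong_of_two_branches hW hB hp (fun j hj => (heq j hj).symm)
    (fun i j hij => (hne j i hij.symm).imp Eq.symm fun h => (hne j i hij.symm).1 ▸ h)
    (fun x => (hs x).trans and_comm) hinf hz h₂ hQ₁ hi₂β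
    (fun j => (hi₂m _).trans (hfp j)) fun x => (hi₂m _).trans (hfr x)
  obtain ⟨hinjβ, hstβ⟩ := hcov.strong_of_basis hW hB.free_b (θ := i₂.comp β₂)
    (by rw [hi₂β]; exact hQ₂)
  refine ⟨_, _, i₁, i₂, hinj₁, hinj₂, hinjβ, hst₁, hst₂, hstβ, fun x => ?_, ?_⟩
  · exact DFunLike.congr_fun (f := i₁.comp m₁) (g := i₂.comp m₂)
      (hc.hom_ext hv fun x => (hi₁m x).trans (hi₂m x).symm) x
  · rintro ⟨x, hx⟩
    -- `ρ` inverts `γ₁` and kills the `z` of the second copy, so it sends that copy into `A`. A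
    -- common element equal to `γ₁ (b 0)` would give `b 0 ∈ A`.
    let ρ : VFree W T →* B := (isFreeBasis_vof T).lift hB.free_b.1
      (Sum.elim (Sum.elim (fun j => a j.down) fun _ => 1) (Sum.elim z fun _ => 1))
    have hρ : ∀ t, ρ (vof W t) = Sum.elim (Sum.elim (fun j : U => a j.down) fun _ => 1)
        (Sum.elim z fun _ => 1) t := fun t => (isFreeBasis_vof T).lift_apply hB.free_b.1 _ t
    have hρ₁ : ρ.comp γ₁ = MonoidHom.id B := by
      apply hz.hom_ext hB.free_b.1
      rintro (j | t)
      · exact (congrArg ρ (ha₁ j j.2)).trans (hρ _)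
      · exact (congrArg ρ (hz₁ t)).trans (hρ _)
    have hρ₂ : ρ (γ₂ x) ∈ Subgroup.closure (Set.range a) := by
      have hx : x ∈ Subgroup.closure (Set.range (Sum.elim (fun j : {j | j ≤ k} => a j) z)) :=
        hz.closure_range ▸ Subgroup.mem_top x
      refine map_mem_closure (ρ.comp γ₂) ?_ hx
      rintro _ ⟨j | t, rfl⟩
      · have : ρ (γ₂ (a j)) = a j := (congrArg ρ (ha₂ j j.2)).trans (hρ _)
        change ρ (γ₂ (a j)) ∈ _
        rw [this]
        exact Subgroup.subset_closure ⟨j, rfl⟩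
      · have : ρ (γ₂ (z t)) = 1 := (congrArg ρ (hz₂ t)).trans (hρ _)
        change ρ (γ₂ (z t)) ∈ _
        rw [this]
        exact Subgroup.one_mem _
    rw [hi₂β] at hx
    have hx' : γ₂ x = γ₁ (b 0) := hx.trans (DFunLike.congr_fun hi₁β (b 0))
    apply hB.b_zero_notMem hW
    rw [hx'] at hρ₂
    rwa [show ρ (γ₁ (b 0)) = b 0 from DFunLike.congr_fun hρ₁ (b 0)] at hρ₂

end IsAECCovering

end Variety

/-! ### The tree of finite sequences and the count of types. -/

section Variety

variable {W : Set (FreeGroup ℕ)}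

/-- The `i`-th node on the branch `ν` of the tree of finite sequences. -/
def treeNode {I : Type*} (ν : ℕ → I) (i : ℕ) : List I := (List.range i).map ν

theorem length_treeNode {I : Type*} (ν : ℕ → I) (i : ℕ) : (treeNode ν i).length = i := by
  simp [treeNode]

theorem treeNode_injective {I : Type*} (ν : ℕ → I) : Function.Injective (treeNode ν) :=
  fun i j h => by rw [← length_treeNode ν i, h, length_treeNode]

theorem treeNode_eq_iff {I : Type*} {ν η : ℕ → I} {i : ℕ} :
    treeNode ν i = treeNode η i ↔ ∀ j < i, ν j = η j := by
  simp [treeNode]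

/-- Here `k` is the first place where the branches differ. Node `i` records only the values below
`i`, so node `k` itself is still shared. -/
theorem exists_splitting {I : Type*} {ν η : ℕ → I} (h : ν ≠ η) :
    ∃ k, (∀ j ≤ k, treeNode ν j = treeNode η j) ∧
      ∀ i j, treeNode ν i = treeNode η j → i = j ∧ i ≤ k := by
  classical
  have h' : ∃ k, ν k ≠ η k := Function.ne_iff.1 h
  refine ⟨Nat.find h', fun j hj => ?_, fun i j hij => ?_⟩
  · exact treeNode_eq_iff.2 fun i hi => not_not.1 (Nat.find_min h' (hi.trans_le hj))
  · obtain rfl : i = j := by rw [← length_treeNode ν i, hij, length_treeNode]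
    refine ⟨rfl, not_lt.1 fun hlt => Nat.find_spec h' (treeNode_eq_iff.1 hij _ hlt)⟩

/-- One-term sequences `[c]` with `c` different from `ν 0` and `η 0` are on neither branch. -/
theorem infinite_compl_branches {I : Type*} [Infinite I] (ν η : ℕ → I) :
    (Set.range (treeNode ν) ∪ Set.range (treeNode η))ᶜ.Infinite := by
  have h : ({ν 0, η 0} : Set I)ᶜ.Infinite := (Set.toFinite _).infinite_compl
  refine (h.image (f := fun c => [c]) fun c _ d _ hcd => by simpa using hcd).mono ?_
  rintro _ ⟨c, hc, rfl⟩
  have key : ∀ (μ : ℕ → I) i, treeNode μ i = [c] → c = μ 0 := fun μ i hi => by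
    obtain rfl : i = 1 := by rw [← length_treeNode μ i, hi]; rfl
    simpa [treeNode] using hi.symm
  rintro (⟨i, hi⟩ | ⟨i, hi⟩)
  · exact hc (Or.inl (key ν i hi))
  · exact hc (Or.inr (key η i hi))

theorem IsFreeBasis.mk_eq (hW : ∃ (G : Type u) (_ : Group G), InVariety W G ∧ Nontrivial G)
    {G : Type u} [Group G] {X : Type u} [Infinite X] {c : X → G} (hc : IsFreeBasis W c) :
    #G = #X := by
  refine le_antisymm ?_ (mk_le_of_injective (hc.injective hW))
  have hsurj : Function.Surjective (FreeGroup.lift c) := by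
    rw [← MonoidHom.range_eq_top, FreeGroup.range_lift_eq_closure, hc.closure_range]
  refine (mk_le_of_surjective hsurj).trans ?_
  rw [mk_freeGroup, max_eq_left (aleph0_le_mk X)]

/-- The index `μ.ord + ω` makes the aleph of cofinality `ω`, and König's theorem applies. -/
theorem exists_lt_power_aleph0 (μ : Cardinal.{u}) : ∃ lam, μ ≤ lam ∧ ℵ₀ ≤ lam ∧ lam < lam ^ ℵ₀ := by
  have hinf := aleph0_le_aleph (μ.ord + Ordinal.omega0)
  refine ⟨ℵ_ (μ.ord + Ordinal.omega0), (le_aleph_ord μ).trans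
    (aleph_le_aleph.2 le_self_add), hinf, ?_⟩
  have h := lt_power_cof_ord hinf
  rwa [ord_aleph, Ordinal.cof_omega (Ordinal.isSuccLimit_add _ Ordinal.isSuccLimit_omega0),
    Ordinal.cof_add _ Ordinal.omega0_ne_zero, Ordinal.cof_omega0] at h

/-- The Galois type over `M` of an element of a strong extension. -/
def AbstractClass.galoisType {L : FirstOrder.Language.{0, 0}} {K : AbstractClass.{w} L}
    {M N : Type w} [L.Structure M] [L.Structure N] {m : M ↪[L] N} (hm : K.Strong m) (x : N) :
    K.GaloisType (asStr L M) :=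
  Quot.mk _ ⟨asStr L N, m, hm, x⟩

namespace IsAECCovering

open AbstractClass

variable {K : AbstractClass.{u} groupLang} (hcov : IsAECCovering W K)
include hcov

/-- Points over different branches have different Galois types. -/
theorem galoisType_ne (hW : IsTorsionFreeVariety.{u} W) {B M P₁ P₂ : Type u}
    [Group B] [Group M] [Group P₁] [Group P₂] {a b : ℕ → B} (hB : IsRCPWitness W B a b)
    (hSE : IsStrongEnough W K B a b)
    {X : Type u} {c : X → M} (hc : IsFreeBasis W c) {p q : ℕ → X} (hp : Function.Injective p)
    (hq : Function.Injective q) {k : ℕ} (heq : ∀ j ≤ k, p j = q j)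
    (hne : ∀ i j, p i = q j → i = j ∧ i ≤ k) (hinf : (Set.range p ∪ Set.range q)ᶜ.Infinite)
    {m₁ : M →* P₁} {β₁ : B →* P₁} (h₁ : IsBranch W a b c p m₁ β₁)
    {m₂ : M →* P₂} {β₂ : B →* P₂} (h₂ : IsBranch W a b c q m₂ β₂)
    (hm₁ : Function.Injective m₁) (hm₂ : Function.Injective m₂)
    (hs₁ : K.Strong (homEmb m₁ hm₁)) (hs₂ : K.Strong (homEmb m₂ hm₂)) :
    galoisType hs₁ (β₁ (b 0)) ≠ galoisType hs₂ (β₂ (b 0)) := by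
  intro htype
  obtain ⟨Q, _, i₁, i₂, hi₁, hi₂, hβ, hsi₁, hsi₂, hsβ, hi, hnot⟩ :=
    hcov.exists_amalgam_of_branches hW hB hc hp hq heq hne hinf h₁ h₂
  obtain ⟨κ₀, hκ₀⟩ := hSE.dcl_aut
  obtain ⟨κ, hκ, N, _, k, f, hN, hk, hfix, hf⟩ := hcov.isAEC.exists_monster_automorphism
    hcov.ap hcov.jep (homEmb m₁ hm₁) (homEmb m₂ hm₂) hs₁ hs₂ (β₁ (b 0)) (β₂ (b 0)) htype
    (homEmb i₁ hi₁) (homEmb i₂ hi₂) hsi₁ hsi₂ hi κ₀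
  let j : B ↪[groupLang] N := k.comp (homEmb (i₂.comp β₂) hβ)
  have hj : K.Strong j := hcov.isAEC.comp hsβ hk
  have hfj : ∀ x ∈ Subgroup.closure (Set.range a), f (j x) = j x := by
    intro x hx
    -- The copy of `A` in the second branch comes from `M`, which `f` fixes pointwise.
    have hle : Subgroup.closure (Set.range a) ≤ m₂.range.comap β₂ := by
      rw [Subgroup.closure_le]
      rintro _ ⟨i, rfl⟩
      exact ⟨c (q i), h₂.map_branch i⟩
    obtain ⟨g, hg⟩ := hle hx
    have hjx : j x = k (i₁ (m₁ g)) := by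
      rw [hi, hg]
      rfl
    rw [hjx]
    exact hfix g
  have hdcl := hκ₀ κ hκ (asStr groupLang N) hN j hj f hfj
  have hdcl' : j '' dclQF groupLang ((Subgroup.closure (Set.range a) : Set B) ∪ {b 0}) =
      dclQF groupLang (j '' ((Subgroup.closure (Set.range a) : Set B) ∪ {b 0})) :=
    hSE.dcl_eq (asStr groupLang N) j hj
  -- The closure of `A` and `j (b 0)` in `N` is exactly the image of `B`. It is also the closure of
  -- `A` and `f (j (b 0))`, so the latter element lies in that image.
  rw [hB.dcl_eq, Set.image_union, Set.image_singleton, Set.image_univ] at hdcl'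
  replace hdcl' := hdcl'.trans hdcl
  have hmem : f (j (b 0)) ∈ Set.range j := by
    rw [hdcl']
    exact fun T hT => hT.1 (Or.inr rfl)
  obtain ⟨x, hx⟩ := hmem
  have : k (i₂ (β₂ x)) = k (i₁ (β₁ (b 0))) := hx.trans hf
  exact hnot ⟨x, k.injective this⟩

theorem not_isSuperstable (hW : IsTorsionFreeVariety.{u} W) {B : Type u} [Group B] {a b : ℕ → B}
    (hB : IsRCPWitness W B a b) (hSE : IsStrongEnough W K B a b) : ¬ K.IsSuperstable := by
  rintro ⟨μ, hμ⟩
  obtain ⟨lam, hle, hinf, hlt⟩ := exists_lt_power_aleph0 μ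
  let I : Type u := lam.out
  have hI : #I = lam := mk_out lam
  have : Infinite I := infinite_iff.2 (hI ▸ hinf)
  -- The tree has `lam` nodes, hence `M` has size `lam`, but it has `lam ^ ℵ₀` branches.
  let M : Type u := VFree W (List I)
  have hc : IsFreeBasis W (vof W : List I → M) := isFreeBasis_vof _
  have hM : #M = lam := by rw [hc.mk_eq hW.1, mk_list_eq_mk, hI]
  have hstab := hμ lam hle (asStr groupLang M) (hcov.mem_of_basis hW hc) hM
  choose P _ m β h using fun ν : ℕ → I => hc.exists_isBranch (a := a) hB.free_b
    (treeNode_injective ν)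
  choose hm hs using fun ν : ℕ → I => hcov.strong_of_isBranch hW hB hc (treeNode_injective ν)
    ((infinite_compl_branches ν ν).mono (by simp)) (h ν)
  let F : (ℕ → I) → K.GaloisType (asStr groupLang M) := fun ν =>
    galoisType (hs ν) (β ν (b 0))
  have hF : Function.Injective F := by
    intro ν η hνη
    by_contra hne
    obtain ⟨k, h1, h2⟩ := exists_splitting hne
    exact hcov.galoisType_ne hW hB hSE hc (treeNode_injective ν) (treeNode_injective η) h1 h2
      (infinite_compl_branches ν η) (h ν) (h η) (hm ν) (hm η) (hs ν) (hs η) hνη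
  have hcard := lift_mk_le_lift_mk_of_injective hF
  rw [mk_arrow, hI, mk_nat, lift_uzero, lift_aleph0] at hcard
  exact (Cardinal.lift_le.1 ((hcard.trans_eq (lift_id'.{u, u + 1} _)).trans hstab)).not_gt hlt

end IsAECCovering

end Variety

end ConstructionPrinciple

open ConstructionPrinciple
theorem corollary1p9 (W : Set (FreeGroup ℕ)) (htf : IsTorsionFreeVariety.{u} W)
    (hroot : ∀ (F : Type u) [Group F] (X : Set F), IsFreeBasis W (fun x : X => (x : F)) →
      ∀ x ∈ X, ∀ (y : F) (n : ℕ), 0 < n → x ^ n = y ^ n → x = y) :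
    (∀ (B : Type u) [Group B] (b : ℕ → B), IsFreeBasis W b →
      IsRCPWitness W B (fun i => b i * (b (i + 1)) ^ (-2 : ℤ)) b) ∧
    RCP.{u} W ∧
    (∀ (B : Type u) [Group B] (a b : ℕ → B), IsRCPWitness W B a b →
      ∀ K : AbstractClass.{u} groupLang, IsAECCovering W K → IsStrongEnough W K B a b →
        ¬ K.IsSuperstable) := by
  have hwit : ∀ (B : Type u) [Group B] (b : ℕ → B), IsFreeBasis W b →
      IsRCPWitness W B (fun i => b i * (b (i + 1)) ^ (-2 : ℤ)) b := fun B _ b hb =>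
    hb.isRCPWitness_twist htf fun i y hy =>
      (hroot B _ (hb.subtype_range (hb.injective htf.1)) (b i) ⟨i, rfl⟩ y 2 two_pos
        (by rw [pow_two, pow_two, hy])).symm
  refine ⟨hwit, ?_, fun B _ a b hB K hcov hSE => hcov.not_isSuperstable htf hB hSE⟩
  exact ⟨VFree W (ULift.{u} ℕ), inferInstance, _, _,
    hwit _ _ ((isFreeBasis_vof _).reindex Equiv.ulift.symm)⟩
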